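/- Let $\mathcal M$ be a connected smooth finite-dimensional Riemannian manifold without boundary, of dimension at least one, with Riemannian distance $d$ and Levi-Civita connection $\nabla$. Let $\mathcal X\subseteq\mathcal M$ be compact and g-convex, meaning that any two points $x,y\in\mathcal X$ are joined by exactly one geodesic $\gamma_{xy}:[0,1]\to\mathcal M$ that stays in $\mathcal X$, and that this geodesic is length-minimizing in $\mathcal M$ (on a Hadamard manifold this just says that $\mathcal X$ contains the geodesic between any two of its points). For $x,y\in\mathcal X$ write $\mathrm{Exp}_x^{-1}(y):=\dot\gamma_{xy}(0)\in T_x\mathcal M$ and let $\Gamma_y^x$ be the parallel transport along $\gamma_{yx}$. Let $\phi:\mathcal M\to\mathbb R$ be differentiable at every point of $\mathcal X$, with Riemannian gradient $\mathrm{grad}\,\phi$, and suppose that * there is a constant $L$ with $\|\mathrm{grad}\,\phi(x)-\Gamma_y^x\,\mathrm{grad}\,\phi(y)\|\le L\,d(x,y)$ for all $x,y\in\mathcal X$; * $\phi$ is $\mu$-strongly g-convex on $\mathcal X$ with $\mu>0$: $\phi(y)\ge\phi(x)+\langle\mathrm{grad}\,\phi(x),\mathrm{Exp}_x^{-1}(y)\rangle+\frac{\mu}{2}d(x,y)^2$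 for all $x,y\in\mathcal X$; * $X^*$ is a minimizer of $\phi$ over $\mathcal X$, and for some $r>0$ the open geodesic ball $B_r(X^*)$ of radius $r$ centred at $X^*$ is contained in $\mathcal X$. Let $$M_\phi:=\sup_{\substack{x,z\in\mathcal X,\ \eta\in(0,1]\\ y=\gamma_{xz}(\eta)}}\frac{2}{\eta^2}\Big[\phi(y)-\phi(x)-\langle\mathrm{grad}\,\phi(x),\mathrm{Exp}_x^{-1}(y)\rangle\Big]$$ be the curvature constant. Let $(X_k)_{k\ge0}$ be generated by the Riemannian Frank-Wolfe method (RFW) with step sizes $s_k$: $X_0\in\mathcal X$, $Z_k\in\arg\min_{z\in\mathcal X}\langle\mathrm{grad}\,\phi(X_k),\mathrm{Exp}_{X_k}^{-1}(z)\rangle$, and $X_{k+1}=\gamma_{X_kZ_k}(s_k)$. Put $\Delta_k:=\phi(X_k)-\phi(X^*)$ and let $$s_k=\frac{r\sqrt{\mu\Delta_k}}{\sqrt2\,M_\phi}.$$ Then $0<M_\phi<\infty$ and $0<\frac{r^2\mu}{4M_\phi}<1$; the method is well defined, that is, $X_k\in\mathcal X$ and $s_k\in[0,1]$ for all $k$;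 and RFW converges linearly: for all $k\ge0$, $$\Delta_{k+1}\le\Big(1-\frac{r^2\mu}{4M_\phi}\Big)\Delta_k,\qquad\text{hence}\qquad \Delta_k\le\Big(1-\frac{r^2\mu}{4M_\phi}\Big)^k\Delta_0 .$$ -/

import Mathlib

open Bundle Set Manifold
open scoped ContDiff

noncomputable section

namespace RFW

section Geometry

variable {E : Type*} [NormedAddCommGroup E] [NormedSpace ℝ E] [FiniteDimensional ℝ E]
  {M : Type*} [MetricSpace M] [ChartedSpace E M] [IsManifold 𝓘(ℝ, E) ∞ M]
  [RiemannianBundle (fun x : M => TangentSpace 𝓘(ℝ, E) x)]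

instance instFiniteDimensionalTangent (x : M) :
    FiniteDimensional ℝ (TangentSpace 𝓘(ℝ, E) x) :=
  inferInstanceAs (FiniteDimensional ℝ E)

instance instCompleteTangent (x : M) : CompleteSpace (TangentSpace 𝓘(ℝ, E) x) :=
  FiniteDimensional.complete ℝ _

/-- The velocity `γ'(t)` of a curve parametrized by `[0, 1]` (one-sided at the endpoints). -/
def velocity (γ : ℝ → M) (t : ℝ) : TangentSpace 𝓘(ℝ, E) (γ t) :=
  mfderivWithin 𝓘(ℝ, ℝ) 𝓘(ℝ, E) γ (Icc 0 1) t (1 : ℝ)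

/-- The Riemannian gradient: the vector representing the differential `Dφ(x)`. -/
def grad (φ : M → ℝ) (x : M) : TangentSpace 𝓘(ℝ, E) x :=
  (InnerProductSpace.toDual ℝ (TangentSpace 𝓘(ℝ, E) x)).symm
    (mvfderiv 𝓘(ℝ, E) φ x)

/-- The Levi-Civita connection: the smooth connection on the tangent bundle that is compatible
with the metric and torsion-free (these properties determine it). -/
structure IsLeviCivita [IsContMDiffRiemannianBundle 𝓘(ℝ, E) ∞ E
      (fun x : M => TangentSpace 𝓘(ℝ, E) x)]
    (cov : CovariantDerivative 𝓘(ℝ, E) E (TangentSpace 𝓘(ℝ, E) : M → Type _)) : Prop where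
  smooth : CovariantDerivative.ContMDiffCovariantDerivative cov ∞
  metric : CovariantDerivative.IsMetricCompatible (I := 𝓘(ℝ, E)) (F := E)
    (V := (TangentSpace 𝓘(ℝ, E) : M → Type _)) (by exact cov)
  torsion_free : cov.torsion = 0

variable (cov : CovariantDerivative 𝓘(ℝ, E) E (TangentSpace 𝓘(ℝ, E) : M → Type _))

/-- `V` is a parallel vector field along the `C¹` curve `γ : [0, 1] → M`. For a connection that is
compatible with the metric, `d/dt ⟪V, W ∘ γ⟫ = ⟪D_t V, W ∘ γ⟫ + ⟪V, ∇_{γ'} W⟫` for all vector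
fields `W`, so that the condition below says that `V` is differentiable with `D_t V = 0`. -/
def IsParallelAlong (γ : ℝ → M) (V : ∀ t : ℝ, TangentSpace 𝓘(ℝ, E) (γ t)) : Prop :=
  ∀ t ∈ Icc (0 : ℝ) 1, ∀ W : ∀ p : M, TangentSpace 𝓘(ℝ, E) p,
    MDifferentiableAt 𝓘(ℝ, E) (𝓘(ℝ, E).prod 𝓘(ℝ, E))
      (fun p => (⟨p, W p⟩ : TotalSpace E (TangentSpace 𝓘(ℝ, E) : M → Type _))) (γ t) →
    HasDerivWithinAt (fun s => inner ℝ (V s) (W (γ s)))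
      (inner ℝ (V t) (cov W (γ t) (velocity γ t))) (Icc 0 1) t

/-- `γ : [0, 1] → M` is a geodesic: its velocity is parallel along it. -/
def IsGeodesic (γ : ℝ → M) : Prop :=
  ContMDiffOn 𝓘(ℝ, ℝ) 𝓘(ℝ, E) 1 γ (Icc 0 1) ∧ IsParallelAlong cov γ (velocity γ)

/-- `γ : [0, 1] → M` is a geodesic from `x` to `y` that stays in `X`. -/
structure IsGeodesicIn (X : Set M) (x y : M) (γ : ℝ → M) : Prop where
  geodesic : IsGeodesic cov γ
  source : γ 0 = x
  target : γ 1 = y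
  mem : ∀ t ∈ Icc (0 : ℝ) 1, γ t ∈ X

/-- `X` is g-convex: any two points of `X` are joined by exactly one geodesic in `X`, and this
geodesic is length-minimizing in the ambient manifold. -/
def GConvex (X : Set M) : Prop :=
  ∀ x ∈ X, ∀ y ∈ X, ∃ γ : ℝ → M, IsGeodesicIn cov X x y γ ∧
    pathELength 𝓘(ℝ, E) γ 0 1 = edist x y ∧
    ∀ γ' : ℝ → M, IsGeodesicIn cov X x y γ' → EqOn γ' γ (Icc 0 1)

open Classical in
/-- The geodesic map: the geodesic `γ_{xy} : [0, 1] → X` from `x` to `y`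
(the constant curve if there is none). -/
def geod (X : Set M) (x y : M) : ℝ → M :=
  if h : ∃ γ : ℝ → M, IsGeodesicIn cov X x y γ then h.choose else fun _ => x

theorem geod_zero (X : Set M) (x y : M) : geod cov X x y 0 = x := by
  unfold geod
  split_ifs with h
  · exact h.choose_spec.source
  · rfl

/-- `Exp_x⁻¹(y)`: the initial velocity of the geodesic from `x` to `y`. -/
def expInv (X : Set M) (x y : M) : TangentSpace 𝓘(ℝ, E) x :=
  geod_zero cov X x y ▸ velocity (geod cov X x y) 0

/-- `v = Γ_y^x u`: `v` is the parallel transport of `u` along the geodesic from `y` to `x`. -/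
def IsParallelTransport (X : Set M) (y x : M) (u : TangentSpace 𝓘(ℝ, E) y)
    (v : TangentSpace 𝓘(ℝ, E) x) : Prop :=
  ∃ V : ∀ t : ℝ, TangentSpace 𝓘(ℝ, E) (geod cov X y x t),
    IsParallelAlong cov (geod cov X y x) V ∧
    (⟨_, V 0⟩ : TangentBundle 𝓘(ℝ, E) M) = ⟨y, u⟩ ∧
    (⟨_, V 1⟩ : TangentBundle 𝓘(ℝ, E) M) = ⟨x, v⟩

/-- `φ` has an `L`-Lipschitz gradient on `X`. -/
def LipschitzGradient (X : Set M) (φ : M → ℝ) (L : ℝ) : Prop :=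
  ∀ x ∈ X, ∀ y ∈ X, ∃ v : TangentSpace 𝓘(ℝ, E) x,
    IsParallelTransport cov X y x (grad φ y) v ∧ ‖grad φ x - v‖ ≤ L * dist x y

/-- `φ` is `μ`-strongly g-convex on `X`. -/
def StronglyGConvexOn (X : Set M) (φ : M → ℝ) (μ : ℝ) : Prop :=
  ∀ x ∈ X, ∀ y ∈ X,
    φ x + inner ℝ (grad φ x) (expInv cov X x y) + μ / 2 * dist x y ^ 2 ≤ φ y

/-- The values whose supremum is the curvature constant: `x, z` range over `X`, `η` over `(0, 1]`,
and `y = γ_{xz}(η)`. -/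
def curvatureValues (X : Set M) (φ : M → ℝ) : Set ℝ :=
  {c | ∃ x ∈ X, ∃ z ∈ X, ∃ η ∈ Ioc (0 : ℝ) 1, ∃ y, y = geod cov X x z η ∧
    c = 2 / η ^ 2 * (φ y - φ x - inner ℝ (grad φ x) (expInv cov X x y))}

/-- The curvature constant `M_φ`. -/
def curvatureConst (X : Set M) (φ : M → ℝ) : ℝ := sSup (curvatureValues cov X φ)

/-- `x₀, x₁, …` are the iterates and `z₀, z₁, …` the oracle answers of a run of the Riemannian
Frank-Wolfe method on `X` with step sizes `s`. -/
structure IsRun (X : Set M) (φ : M → ℝ) (s : ℕ → ℝ) (x z : ℕ → M) : Prop where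
  init : x 0 ∈ X
  oracle_mem : ∀ k, z k ∈ X
  oracle_min : ∀ k, ∀ w ∈ X,
    inner ℝ (grad φ (x k)) (expInv cov X (x k) (z k)) ≤
      inner ℝ (grad φ (x k)) (expInv cov X (x k) w)
  step : ∀ k, x (k + 1) = geod cov X (x k) (z k) (s k)

end Geometry

end RFW

end

/-! Write `M` for the curvature constant, `g = -⟨grad φ(x), Exp_x⁻¹(z)⟩` for the Frank-Wolfe gap at
an iterate `x`, `D = d(x, X*)` and `Δ = φ(x) - φ(X*)`. By definition of `M`, a step `s` changes `φ`
by at most `-s g + s² M / 2` (`le_curvatureConst`). The heart of the matter is the bound `g ≥ r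
√(μΔ) / √2` (`StronglyGConvexOn.gap_le`). If `D ≥ r/2`, testing the oracle against `X*` and using
strong convexity gives `g ≥ Δ + μD²/2 ≥ √(2μΔ) D`. If `D < r/2`, a ball of radius greater than `r/2`
about `x` lies in `X`, so the oracle can be tested in the direction of steepest descent: `g ≥ (r/2)
‖grad φ(x)‖`, and strong convexity yields `‖grad φ(x)‖ ≥ √(2μΔ)`. The prescribed step is this lower
bound divided by `M`, so it gains at least `s² M / 2 = r²μ/(4M) Δ`.

The constant `M` is finite because a Lipschitz gradient gives a quadratic upper model
(`LipschitzGradient.le_add`), and strong convexity forces `M ≥ μρ²` for every `ρ < r`, which puts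
the rate in `(0, 1)`. The gradient vanishes at `X*`, so `Δ ≤ M/2` on `X`, and this keeps the steps
below 1.

The geometric input is `GConvex.exists_expVec_eq`: a short initial velocity at the centre of a ball
in `X` is realized by a point of `X`. Completeness of the manifold is not assumed. Geodesics solve a
differential equation in a chart and an orthonormal frame, exist up to time 1 for uniformly small
velocities on the compact set `X`, and are prolonged piece by piece; constant speed keeps them in
the ball, and uniqueness in `X` identifies them with `geod`. Constant speed itself comes from the
skew-symmetry of the connection in an orthonormal frame. -/

noncomputable section

namespace RFW

open Filter Topology

set_option linter.unusedSectionVars false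

/-! ### Smooth local orthonormal frames. -/

section Frames

variable {E : Type*} [NormedAddCommGroup E] [NormedSpace ℝ E]
  {M : Type*} [TopologicalSpace M] [ChartedSpace E M] [IsManifold 𝓘(ℝ, E) ∞ M]
  [RiemannianBundle (fun x : M => TangentSpace 𝓘(ℝ, E) x)]
  [IsContMDiffRiemannianBundle 𝓘(ℝ, E) ∞ E (fun x : M => TangentSpace 𝓘(ℝ, E) x)]

theorem contMDiffOn_inner {u : Set M} {V W : ∀ x : M, TangentSpace 𝓘(ℝ, E) x}
    (hV : ContMDiffOn 𝓘(ℝ, E) (𝓘(ℝ, E).prod 𝓘(ℝ, E)) ∞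
      (fun x => (⟨x, V x⟩ : TangentBundle 𝓘(ℝ, E) M)) u)
    (hW : ContMDiffOn 𝓘(ℝ, E) (𝓘(ℝ, E).prod 𝓘(ℝ, E)) ∞
      (fun x => (⟨x, W x⟩ : TangentBundle 𝓘(ℝ, E) M)) u) :
    ContMDiffOn 𝓘(ℝ, E) 𝓘(ℝ, ℝ) ∞ (fun x => inner ℝ (V x) (W x)) u :=
  ContMDiffOn.inner_bundle (E := (TangentSpace 𝓘(ℝ, E) : M → Type _)) hV hW

/-- Gram-Schmidt orthogonalization of a smooth pointwise linearly independent family of vector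
fields is smooth. -/
theorem contMDiffOn_gramSchmidt {n : ℕ} {u : Set M}
    {e : Fin n → ∀ x : M, TangentSpace 𝓘(ℝ, E) x}
    (he : ∀ i, ContMDiffOn 𝓘(ℝ, E) (𝓘(ℝ, E).prod 𝓘(ℝ, E)) ∞
      (fun x => (⟨x, e i x⟩ : TangentBundle 𝓘(ℝ, E) M)) u)
    (hli : ∀ x ∈ u, LinearIndependent ℝ (fun i => e i x)) (i : Fin n) :
    ContMDiffOn 𝓘(ℝ, E) (𝓘(ℝ, E).prod 𝓘(ℝ, E)) ∞
      (fun x => (⟨x, InnerProductSpace.gramSchmidt ℝ (fun i => e i x) i⟩ :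
        TangentBundle 𝓘(ℝ, E) M)) u := by
  induction i using WellFoundedLT.induction with
  | ind i ih =>
  have h1 : ∀ x, InnerProductSpace.gramSchmidt ℝ (fun i => e i x) i =
      e i x - ∑ j ∈ Finset.Iio i,
      (inner ℝ (InnerProductSpace.gramSchmidt ℝ (fun i => e i x) j) (e i x) /
        inner ℝ (InnerProductSpace.gramSchmidt ℝ (fun i => e i x) j)
          (InnerProductSpace.gramSchmidt ℝ (fun i => e i x) j)) •
          InnerProductSpace.gramSchmidt ℝ (fun i => e i x) j := by
    intro x
    have := InnerProductSpace.gramSchmidt_def'' ℝ (fun i => e i x) i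
    simp only [RCLike.ofReal_real_eq_id, id, ← real_inner_self_eq_norm_sq] at this
    exact eq_sub_of_add_eq this.symm
  simp_rw [h1]
  refine (he i).sub_section (ContMDiffOn.sum_section fun j hj => ?_)
  have hj' := ih j (Finset.mem_Iio.1 hj)
  refine ContMDiffOn.smul_section ?_ hj'
  refine (contMDiffOn_inner hj' (he i)).div₀ (contMDiffOn_inner hj' hj') fun x hx => ?_
  exact inner_self_ne_zero.2 (InnerProductSpace.gramSchmidt_ne_zero j (hli x hx))

theorem contMDiffOn_gramSchmidtNormed {n : ℕ} {u : Set M}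
    {e : Fin n → ∀ x : M, TangentSpace 𝓘(ℝ, E) x}
    (he : ∀ i, ContMDiffOn 𝓘(ℝ, E) (𝓘(ℝ, E).prod 𝓘(ℝ, E)) ∞
      (fun x => (⟨x, e i x⟩ : TangentBundle 𝓘(ℝ, E) M)) u)
    (hli : ∀ x ∈ u, LinearIndependent ℝ (fun i => e i x)) (i : Fin n) :
    ContMDiffOn 𝓘(ℝ, E) (𝓘(ℝ, E).prod 𝓘(ℝ, E)) ∞
      (fun x => (⟨x, InnerProductSpace.gramSchmidtNormed ℝ (fun i => e i x) i⟩ :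
        TangentBundle 𝓘(ℝ, E) M)) u := by
  have h := contMDiffOn_gramSchmidt he hli i
  refine ContMDiffOn.smul_section ?_ h
  have h2 : ∀ x, (‖InnerProductSpace.gramSchmidt ℝ (fun i => e i x) i‖ : ℝ)⁻¹ =
      (Real.sqrt (inner ℝ (InnerProductSpace.gramSchmidt ℝ (fun i => e i x) i)
        (InnerProductSpace.gramSchmidt ℝ (fun i => e i x) i)))⁻¹ := by
    intro x
    rw [← norm_eq_sqrt_real_inner]
  simp only [RCLike.ofReal_real_eq_id, id]
  refine ContMDiffOn.congr (f := fun x => (Real.sqrt (inner ℝ (InnerProductSpace.gramSchmidt ℝ (fun i => e i x) i)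
        (InnerProductSpace.gramSchmidt ℝ (fun i => e i x) i)))⁻¹) ?_ fun x _ => h2 x
  intro x hx
  have hne : inner ℝ (InnerProductSpace.gramSchmidt ℝ (fun i => e i x) i)
        (InnerProductSpace.gramSchmidt ℝ (fun i => e i x) i) ≠ (0 : ℝ) :=
    inner_self_ne_zero.2 (InnerProductSpace.gramSchmidt_ne_zero i (hli x hx))
  have h3 : ContDiffAt ℝ ∞ (fun t : ℝ => (Real.sqrt t)⁻¹)
      (inner ℝ (InnerProductSpace.gramSchmidt ℝ (fun i => e i x) i)
        (InnerProductSpace.gramSchmidt ℝ (fun i => e i x) i)) :=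
    (Real.contDiffAt_sqrt hne).inv (Real.sqrt_ne_zero'.2
      (lt_of_le_of_ne real_inner_self_nonneg hne.symm))
  exact ContMDiffAt.comp_contMDiffWithinAt (g := fun t : ℝ => (Real.sqrt t)⁻¹) x h3.contMDiffAt ((contMDiffOn_inner h h) x hx)

/-- A family of smooth vector fields on `M` that is orthonormal on the open set `u`. -/
structure IsOrthonormalFrameOn {n : ℕ} (W : Fin n → ∀ x : M, TangentSpace 𝓘(ℝ, E) x)
    (u : Set M) : Prop where
  isOpen : IsOpen u
  contMDiff : ∀ i, ContMDiff 𝓘(ℝ, E) (𝓘(ℝ, E).prod 𝓘(ℝ, E)) ∞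
    (fun x => (⟨x, W i x⟩ : TangentBundle 𝓘(ℝ, E) M))
  orthonormal : ∀ x ∈ u, Orthonormal ℝ (fun i => W i x)
  card_eq : n = Module.finrank ℝ E

/-- Around every point there is a smooth local orthonormal frame, consisting of globally smooth
vector fields. -/
theorem exists_isOrthonormalFrameOn [FiniteDimensional ℝ E] [T2Space M] (p : M) :
    ∃ (W : Fin (Module.finrank ℝ E) → ∀ x : M, TangentSpace 𝓘(ℝ, E) x) (u : Set M),
      p ∈ u ∧ IsOrthonormalFrameOn W u := by
  let b := Module.finBasis ℝ E
  let t := trivializationAt E (TangentSpace 𝓘(ℝ, E) : M → Type _) p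
  let e := t.localFrame b
  have hf := t.isLocalFrameOn_localFrame_baseSet 𝓘(ℝ, E) ∞ b
  have hG := contMDiffOn_gramSchmidtNormed (fun i => hf.contMDiffOn i)
    (fun x hx => hf.linearIndependent hx)
  have hpb : p ∈ t.baseSet := FiberBundle.mem_baseSet_trivializationAt' p
  -- A cutoff equal to 1 near `p` and supported in the trivialization domain extends the frame by
  -- zero to globally smooth fields, unchanged on `u`.
  obtain ⟨ψ, -, hψ⟩ := (SmoothBumpFunction.nhds_basis_tsupport (I := 𝓘(ℝ, E)) p).mem_iff.1
    (t.open_baseSet.mem_nhds hpb)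
  have hone : ∀ᶠ x in 𝓝 p, ψ x = 1 := ψ.eventuallyEq_one
  obtain ⟨u, hu, huo, hpu⟩ := mem_nhds_iff.1 (hone.and (t.open_baseSet.mem_nhds hpb))
  refine ⟨fun i => (ψ : M → ℝ) • fun x => InnerProductSpace.gramSchmidtNormed ℝ (fun i => e i x) i,
    u, hpu, huo, fun i => ?_, fun x hx => ?_, rfl⟩
  · exact ContMDiffOn.smul_section_of_tsupport ψ.contMDiff.contMDiffOn t.open_baseSet hψ (hG i)
  · have h1 := hu hx
    have := InnerProductSpace.gramSchmidtNormed_orthonormal (𝕜 := ℝ) (hf.linearIndependent h1.2)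
    convert this using 2 with i
    simp [h1.1, e]

end Frames

/-! ### Parallel fields and conservation of inner products. -/

section Parallel

variable {E : Type*} [NormedAddCommGroup E] [NormedSpace ℝ E] [FiniteDimensional ℝ E]
  {M : Type*} [MetricSpace M] [ChartedSpace E M] [IsManifold 𝓘(ℝ, E) ∞ M]
  [RiemannianBundle (fun x : M => TangentSpace 𝓘(ℝ, E) x)]

variable (E) in
/-- The Riemannian metric at `x`, on tangent vectors regarded as elements of the model space. -/
def tinner (x : M) (v w : E) : ℝ :=
  inner ℝ (show TangentSpace 𝓘(ℝ, E) x from v) (show TangentSpace 𝓘(ℝ, E) x from w)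

variable (E) in
/-- The Riemannian norm at `x`, on tangent vectors regarded as elements of the model space. -/
def tnorm (x : M) (v : E) : ℝ := ‖(show TangentSpace 𝓘(ℝ, E) x from v)‖

theorem tinner_self (x : M) (v : E) : tinner E x v v = tnorm E x v ^ 2 :=
  real_inner_self_eq_norm_sq _

theorem tnorm_nonneg (x : M) (v : E) : 0 ≤ tnorm E x v := norm_nonneg _

theorem tnorm_smul (x : M) (c : ℝ) (v : E) : tnorm E x (c • v) = |c| * tnorm E x v :=
  norm_smul c (show TangentSpace 𝓘(ℝ, E) x from v)

theorem tinner_smul_left (x : M) (c : ℝ) (v w : E) : tinner E x (c • v) w = c * tinner E x v w :=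
  real_inner_smul_left _ _ _

theorem tinner_smul_right (x : M) (c : ℝ) (v w : E) : tinner E x v (c • w) = c * tinner E x v w :=
  real_inner_smul_right _ _ _

theorem tinner_sub_left (x : M) (u v w : E) :
    tinner E x (u - v) w = tinner E x u w - tinner E x v w :=
  inner_sub_left _ _ _

theorem tinner_comm (x : M) (v w : E) : tinner E x v w = tinner E x w v :=
  real_inner_comm _ _

theorem tinner_le (x : M) (v w : E) : tinner E x v w ≤ tnorm E x v * tnorm E x w :=
  real_inner_le_norm _ _

theorem tinner_sum_left {ι : Type*} (s : Finset ι) (x : M) (f : ι → E) (w : E) :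
    tinner E x (∑ i ∈ s, f i) w = ∑ i ∈ s, tinner E x (f i) w :=
  sum_inner (𝕜 := ℝ) s (fun i => (show TangentSpace 𝓘(ℝ, E) x from f i)) _

theorem tinner_sum_right {ι : Type*} (s : Finset ι) (x : M) (f : ι → E) (w : E) :
    tinner E x w (∑ i ∈ s, f i) = ∑ i ∈ s, tinner E x w (f i) := by
  simp_rw [tinner_comm x w, tinner_sum_left]

section Frame

variable {n : ℕ} {W : Fin n → ∀ x : M, TangentSpace 𝓘(ℝ, E) x} {u : Set M}

/-- An orthonormal family with as many members as the dimension is a basis. -/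
theorem IsOrthonormalFrameOn.sum_eq (hW : IsOrthonormalFrameOn W u) {x : M} (hx : x ∈ u) (v : E) :
    v = ∑ i, tinner E x v (W i x) • (show E from W i x) := by
  have h := hW.orthonormal x hx
  have hc : Fintype.card (Fin n) = Module.finrank ℝ (TangentSpace 𝓘(ℝ, E) x) := by
    rw [Fintype.card_fin]; exact hW.card_eq
  let B : Module.Basis (Fin n) ℝ (TangentSpace 𝓘(ℝ, E) x) :=
    Module.Basis.mk h.linearIndependent
      (h.linearIndependent.span_eq_top_of_card_eq_finrank' hc).ge
  have hB : ⇑B = fun i => W i x := Module.Basis.coe_mk _ _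
  have ho : Orthonormal ℝ ⇑B := by rw [hB]; exact h
  have := (B.toOrthonormalBasis ho).sum_repr' (show TangentSpace 𝓘(ℝ, E) x from v)
  simp only [Module.Basis.coe_toOrthonormalBasis, hB] at this
  refine this.symm.trans (Finset.sum_congr rfl fun i _ => ?_)
  exact congrArg (· • (show E from W i x)) (tinner_comm (E := E) x (W i x) v)

theorem IsOrthonormalFrameOn.tinner_eq (hW : IsOrthonormalFrameOn W u) {x : M} (hx : x ∈ u)
    (v w : E) : tinner E x v w = ∑ i, tinner E x v (W i x) * tinner E x w (W i x) := by
  conv_lhs => rw [hW.sum_eq hx w]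
  rw [tinner_sum_right]
  refine Finset.sum_congr rfl fun i _ => ?_
  rw [tinner_smul_right, mul_comm]

theorem IsOrthonormalFrameOn.tinner_frame (hW : IsOrthonormalFrameOn W u) {x : M} (hx : x ∈ u)
    (i j : Fin n) : tinner E x (W i x) (W j x) = if i = j then 1 else 0 :=
  orthonormal_iff_ite.1 (hW.orthonormal x hx) i j

theorem IsOrthonormalFrameOn.mdifferentiableAt (hW : IsOrthonormalFrameOn W u) (i : Fin n)
    (x : M) : MDifferentiableAt 𝓘(ℝ, E) (𝓘(ℝ, E).prod 𝓘(ℝ, E))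
      (fun p => (⟨p, W i p⟩ : TangentBundle 𝓘(ℝ, E) M)) x :=
  ((hW.contMDiff i) x).mdifferentiableAt (by simp)

end Frame

variable [IsContMDiffRiemannianBundle 𝓘(ℝ, E) ∞ E (fun x : M => TangentSpace 𝓘(ℝ, E) x)]

variable {cov : CovariantDerivative 𝓘(ℝ, E) E (TangentSpace 𝓘(ℝ, E) : M → Type _)}

theorem IsLeviCivita.mvfderiv_tinner (hcov : IsLeviCivita cov) {x : M}
    {σ τ : ∀ x : M, TangentSpace 𝓘(ℝ, E) x}
    (hσ : MDifferentiableAt 𝓘(ℝ, E) (𝓘(ℝ, E).prod 𝓘(ℝ, E))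
      (fun p => (⟨p, σ p⟩ : TangentBundle 𝓘(ℝ, E) M)) x)
    (hτ : MDifferentiableAt 𝓘(ℝ, E) (𝓘(ℝ, E).prod 𝓘(ℝ, E))
      (fun p => (⟨p, τ p⟩ : TangentBundle 𝓘(ℝ, E) M)) x) (v : E) :
    mvfderiv 𝓘(ℝ, E) (fun p => tinner E p (σ p) (τ p)) x v =
      tinner E x (cov σ x v) (τ x) + tinner E x (σ x) (cov τ x v) :=
  CovariantDerivative.IsMetricCompatible.mvfderiv_inner_eq
    (V := (TangentSpace 𝓘(ℝ, E) : M → Type _)) hcov.metric (fun _ => v) hσ hτ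

/-- In an orthonormal frame, the connection is skew-symmetric. -/
theorem IsLeviCivita.skew (hcov : IsLeviCivita cov) {n : ℕ}
    {W : Fin n → ∀ x : M, TangentSpace 𝓘(ℝ, E) x} {u : Set M} (hW : IsOrthonormalFrameOn W u)
    {x : M} (hx : x ∈ u) (i j : Fin n) (v : E) :
    tinner E x (cov (W i) x v) (W j x) + tinner E x (cov (W j) x v) (W i x) = 0 := by
  have h := hcov.mvfderiv_tinner (hW.mdifferentiableAt i x) (hW.mdifferentiableAt j x) v
  refine (congrArg (tinner E x (cov (W i) x v) (W j x) + ·)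
    (tinner_comm (E := E) x (cov (W j) x v) (W i x))).trans (h.symm.trans ?_)
  have he : (fun p => tinner E p (W i p) (W j p)) =ᶠ[𝓝 x] fun _ => if i = j then (1 : ℝ) else 0 :=
    Filter.eventually_of_mem (hW.isOpen.mem_nhds hx) fun p hp => hW.tinner_frame hp i j
  have h0 : HasMFDerivAt 𝓘(ℝ, E) 𝓘(ℝ, ℝ) (fun p => tinner E p (W i p) (W j p)) x 0 :=
    (hasMFDerivAt_const (if i = j then (1 : ℝ) else 0) x).congr_of_eventuallyEq he
  have : mvfderiv 𝓘(ℝ, E) (fun p => tinner E p (W i p) (W j p)) x = 0 := by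
    rw [mvfderiv, h0.mfderiv]; rfl
  rw [this]; rfl

/-- The derivative of `⟪V, U⟫ = ∑ i, ⟪V, W i⟫ * ⟪U, W i⟫` vanishes if the components of `V` and `U` vary
by parallel transport. -/
theorem IsLeviCivita.sum_skew (hcov : IsLeviCivita cov) {n : ℕ}
    {W : Fin n → ∀ x : M, TangentSpace 𝓘(ℝ, E) x} {u : Set M} (hW : IsOrthonormalFrameOn W u)
    {x : M} (hx : x ∈ u) (w V U : E) :
    ∑ i, (tinner E x V (cov (W i) x w) * tinner E x U (W i x) +
      tinner E x V (W i x) * tinner E x U (cov (W i) x w)) = 0 := by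
  set a := fun i => tinner E x V (W i x)
  set b := fun i => tinner E x U (W i x)
  set c := fun i j => tinner E x (cov (W i) x w) (W j x)
  have hc : ∀ i j, c i j = - c j i := fun i j =>
    eq_neg_of_add_eq_zero_left (hcov.skew hW hx i j w)
  have h1 : ∀ i, tinner E x V (cov (W i) x w) = ∑ j, a j * c i j := fun i =>
    hW.tinner_eq hx _ _
  have h2 : ∀ i, tinner E x U (cov (W i) x w) = ∑ j, b j * c i j := fun i =>
    hW.tinner_eq hx _ _
  -- Both halves are the same bilinear sum up to exchanging `i` and `j`, which by skew-symmetry of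
  -- `c` costs a sign.
  have h3 : ∑ i, (∑ j, a j * c i j) * b i = - ∑ i, a i * ∑ j, b j * c i j := by
    simp_rw [Finset.sum_mul, Finset.mul_sum]
    rw [Finset.sum_comm, ← Finset.sum_neg_distrib]
    refine Finset.sum_congr rfl fun i _ => ?_
    rw [← Finset.sum_neg_distrib]
    refine Finset.sum_congr rfl fun j _ => ?_
    rw [hc j i]; ring
  calc _ = ∑ i, ((∑ j, a j * c i j) * b i + a i * ∑ j, b j * c i j) :=
        Finset.sum_congr rfl fun i _ => congrArg₂ (fun p q => p * b i + a i * q) (h1 i) (h2 i)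
    _ = 0 := by rw [Finset.sum_add_distrib, h3, neg_add_cancel]

variable (cov) in
/-- `V` is parallel along the curve `γ` with velocity `v` on `s`. -/
def ParallelOn (γ : ℝ → M) (v V : ℝ → E) (s : Set ℝ) : Prop :=
  ∀ t ∈ s, ∀ W : ∀ p : M, TangentSpace 𝓘(ℝ, E) p,
    MDifferentiableAt 𝓘(ℝ, E) (𝓘(ℝ, E).prod 𝓘(ℝ, E))
      (fun p => (⟨p, W p⟩ : TangentBundle 𝓘(ℝ, E) M)) (γ t) →
    HasDerivWithinAt (fun r => tinner E (γ r) (V r) (W (γ r)))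
      (tinner E (γ t) (V t) (cov W (γ t) (v t))) s t

/-- The inner product of two parallel fields along a curve is constant. -/
theorem ParallelOn.hasDerivWithinAt_tinner (hcov : IsLeviCivita cov) {γ : ℝ → M} {v V U : ℝ → E}
    {s : Set ℝ} (hγ : ContinuousOn γ s) (hV : ParallelOn cov γ v V s)
    (hU : ParallelOn cov γ v U s) {t : ℝ} (ht : t ∈ s) :
    HasDerivWithinAt (fun r => tinner E (γ r) (V r) (U r)) 0 s t := by
  obtain ⟨W, u, hu, hW⟩ := exists_isOrthonormalFrameOn (E := E) (γ t)
  have hd := HasDerivWithinAt.fun_sum (u := Finset.univ) fun i _ =>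
    (hV t ht (W i) (hW.mdifferentiableAt i _)).mul (hU t ht (W i) (hW.mdifferentiableAt i _))
  have he : ∀ᶠ r in 𝓝[s] t, tinner E (γ r) (V r) (U r) =
      ∑ i, tinner E (γ r) (V r) (W i (γ r)) * tinner E (γ r) (U r) (W i (γ r)) := by
    filter_upwards [(hγ t ht).eventually (hW.isOpen.mem_nhds hu)] with r hr
    exact hW.tinner_eq hr _ _
  refine (hd.congr_of_eventuallyEq he (hW.tinner_eq hu _ _)).congr_deriv ?_
  exact hcov.sum_skew hW hu _ _ _

theorem ParallelOn.tinner_eq (hcov : IsLeviCivita cov) {γ : ℝ → M} {v V U : ℝ → E}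
    (hγ : ContinuousOn γ (Icc 0 1)) (hV : ParallelOn cov γ v V (Icc 0 1))
    (hU : ParallelOn cov γ v U (Icc 0 1)) {t : ℝ} (ht : t ∈ Icc (0 : ℝ) 1) :
    tinner E (γ t) (V t) (U t) = tinner E (γ 0) (V 0) (U 0) := by
  have h := fun r (hr : r ∈ Icc (0 : ℝ) 1) => hV.hasDerivWithinAt_tinner hcov hγ hU hr
  refine constant_of_has_deriv_right_zero (fun r hr => (h r hr).continuousWithinAt)
    (fun r hr => ?_) t ht
  exact (h r (Ico_subset_Icc_self hr)).mono_of_mem_nhdsWithin (Icc_mem_nhdsGE_of_mem hr)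

end Parallel

/-! ### Velocities of curves, in charts and intrinsically. -/

section Velocity

variable {E : Type*} [NormedAddCommGroup E] [NormedSpace ℝ E] [FiniteDimensional ℝ E]
  {M : Type*} [MetricSpace M] [ChartedSpace E M] [IsManifold 𝓘(ℝ, E) ∞ M]

/-- The curve `γ` has velocity `w` at time `t`, within `s`. -/
def HasVelocityWithinAt (γ : ℝ → M) (w : E) (s : Set ℝ) (t : ℝ) : Prop :=
  HasMFDerivWithinAt 𝓘(ℝ, ℝ) 𝓘(ℝ, E) γ s t
    (show TangentSpace 𝓘(ℝ, ℝ) t →L[ℝ] TangentSpace 𝓘(ℝ, E) (γ t) from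
      (ContinuousLinearMap.toSpanSingleton ℝ w : ℝ →L[ℝ] E))

/-- The vector `w` at `x`, read in the chart at `p`. -/
def chartVec (p x : M) (w : E) : E :=
  mfderiv 𝓘(ℝ, E) 𝓘(ℝ, E) (extChartAt 𝓘(ℝ, E) p) x w

theorem chartVec_sum {ι : Type*} (s : Finset ι) (p x : M) (c : ι → ℝ) (f : ι → E) :
    chartVec p x (∑ i ∈ s, c i • f i) = ∑ i ∈ s, c i • chartVec p x (f i) := by
  have h := map_sum (mfderiv 𝓘(ℝ, E) 𝓘(ℝ, E) (extChartAt 𝓘(ℝ, E) p) x)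
    (fun i => (show TangentSpace 𝓘(ℝ, E) x from c i • f i)) s
  refine h.trans (Finset.sum_congr rfl fun i _ => ?_)
  exact map_smul (mfderiv 𝓘(ℝ, E) 𝓘(ℝ, E) (extChartAt 𝓘(ℝ, E) p) x) (c i)
    (show TangentSpace 𝓘(ℝ, E) x from f i)

/-- On the chart domain, the derivative of the chart is the trivialization of the tangent bundle, in
which smoothness of a section is read off. -/
theorem contMDiffOn_chartVec (p : M) {W : ∀ x : M, TangentSpace 𝓘(ℝ, E) x}
    (hW : ContMDiff 𝓘(ℝ, E) (𝓘(ℝ, E).prod 𝓘(ℝ, E)) ∞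
      (fun x => (⟨x, W x⟩ : TangentBundle 𝓘(ℝ, E) M))) :
    ContMDiffOn 𝓘(ℝ, E) 𝓘(ℝ, E) ∞ (fun x => chartVec p x (W x)) (chartAt E p).source := by
  let e := trivializationAt E (TangentSpace 𝓘(ℝ, E) : M → Type _) p
  have h := (e.contMDiffOn_section_baseSet_iff (IB := 𝓘(ℝ, E)) (n := ∞) (s := W)).1
    hW.contMDiffOn
  refine ContMDiffOn.congr h fun x hx => ?_
  have h2 := TangentBundle.continuousLinearMapAt_trivializationAt (I := 𝓘(ℝ, E)) hx
  have h3 : e.continuousLinearMapAt ℝ x (W x) = (e ⟨x, W x⟩).2 := by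
    rw [e.continuousLinearMapAt_apply ℝ, e.linearMapAt_apply, if_pos (show x ∈ e.baseSet from hx)]
  refine Eq.trans ?_ h3
  exact (congrArg (fun L : TangentSpace 𝓘(ℝ, E) x →L[ℝ] E => L (W x)) h2).symm

theorem HasVelocityWithinAt.continuousWithinAt {γ : ℝ → M} {w : E} {s : Set ℝ} {t : ℝ}
    (h : HasVelocityWithinAt γ w s t) : ContinuousWithinAt γ s t :=
  HasMFDerivWithinAt.continuousWithinAt h

theorem HasVelocityWithinAt.chart {γ : ℝ → M} {w : E} {s : Set ℝ} {t : ℝ}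
    (h : HasVelocityWithinAt γ w s t) {p : M} (hp : γ t ∈ (chartAt E p).source) :
    HasDerivWithinAt (fun r => extChartAt 𝓘(ℝ, E) p (γ r)) (chartVec p (γ t) w) s t := by
  have h1 := (mdifferentiableAt_extChartAt (I := 𝓘(ℝ, E)) hp).hasMFDerivAt
  have h2 : HasFDerivWithinAt (fun r => extChartAt 𝓘(ℝ, E) p (γ r))
      (show ℝ →L[ℝ] E from _) s t :=
    (HasMFDerivAt.comp_hasMFDerivWithinAt t h1 h).hasFDerivWithinAt
  refine h2.hasDerivWithinAt.congr_deriv ?_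
  exact congrArg (mfderiv 𝓘(ℝ, E) 𝓘(ℝ, E) (extChartAt 𝓘(ℝ, E) p) (γ t)) (one_smul ℝ w)

/-- Converse of `HasVelocityWithinAt.chart`, used to bring solutions of the geodesic equation from
the chart back to the manifold: the derivatives of the chart and of its inverse compose to the
identity. -/
theorem hasVelocityWithinAt_chart_symm {y : ℝ → E} {p : M} {w : E} {s : Set ℝ} {t : ℝ}
    (hp : y t ∈ (extChartAt 𝓘(ℝ, E) p).target)
    (h : HasDerivWithinAt y (chartVec p ((extChartAt 𝓘(ℝ, E) p).symm (y t)) w) s t) :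
    HasVelocityWithinAt (fun r => (extChartAt 𝓘(ℝ, E) p).symm (y r)) w s t := by
  have h1 := (mdifferentiableWithinAt_extChartAt_symm (I := 𝓘(ℝ, E)) hp).hasMFDerivWithinAt
  have h2 := HasMFDerivWithinAt.comp t h1 h.hasFDerivWithinAt.hasMFDerivWithinAt
    (fun _ _ => by simp)
  refine h2.congr_mfderiv ?_
  have h3 := mfderivWithin_extChartAt_symm_comp_mfderiv_extChartAt (I := 𝓘(ℝ, E)) hp
  have h4 := congrArg (fun L : TangentSpace 𝓘(ℝ, E) ((extChartAt 𝓘(ℝ, E) p).symm (y t)) →L[ℝ]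
    TangentSpace 𝓘(ℝ, E) ((extChartAt 𝓘(ℝ, E) p).symm (y t)) => L w) h3
  refine ContinuousLinearMap.ext fun (c : ℝ) => ?_
  have h5 := congrArg (fun u : E => c • u) h4
  refine Eq.trans ?_ h5
  exact map_smul (mfderivWithin 𝓘(ℝ, E) 𝓘(ℝ, E) (extChartAt 𝓘(ℝ, E) p).symm
    (range 𝓘(ℝ, E)) (y t)) c
    (show E from chartVec p ((extChartAt 𝓘(ℝ, E) p).symm (y t)) w)

theorem HasVelocityWithinAt.mono {γ : ℝ → M} {w : E} {s s' : Set ℝ} {t : ℝ}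
    (h : HasVelocityWithinAt γ w s t) (hs : s' ⊆ s) : HasVelocityWithinAt γ w s' t :=
  HasMFDerivWithinAt.mono h hs

theorem HasVelocityWithinAt.mono_of_mem_nhdsWithin {γ : ℝ → M} {w : E} {s s' : Set ℝ} {t : ℝ}
    (h : HasVelocityWithinAt γ w s t) (hs : s ∈ 𝓝[s'] t) : HasVelocityWithinAt γ w s' t :=
  HasMFDerivWithinAt.mono_of_mem_nhdsWithin h hs

theorem HasVelocityWithinAt.union {γ : ℝ → M} {w : E} {s s' : Set ℝ} {t : ℝ}
    (h : HasVelocityWithinAt γ w s t) (h' : HasVelocityWithinAt γ w s' t) :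
    HasVelocityWithinAt γ w (s ∪ s') t :=
  HasMFDerivWithinAt.union h h'

theorem HasVelocityWithinAt.congr {γ γ' : ℝ → M} {w : E} {s : Set ℝ} {t : ℝ}
    (h : HasVelocityWithinAt γ w s t) (hs : EqOn γ' γ s) (ht : t ∈ s) :
    HasVelocityWithinAt γ' w s t :=
  HasMFDerivWithinAt.congr_mono
    (f' := (ContinuousLinearMap.toSpanSingleton ℝ w : ℝ →L[ℝ] E))
    (show HasMFDerivWithinAt 𝓘(ℝ, ℝ) 𝓘(ℝ, E) γ s t _ from h) hs (hs ht) subset_rfl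

theorem HasVelocityWithinAt.comp {γ : ℝ → M} {w : E} {s s' : Set ℝ} {t : ℝ} {f : ℝ → ℝ} {c : ℝ}
    (h : HasVelocityWithinAt γ w s (f t)) (hf : HasDerivWithinAt f c s' t) (hs : MapsTo f s' s) :
    HasVelocityWithinAt (fun r => γ (f r)) (c • w) s' t := by
  have h2 := HasMFDerivWithinAt.comp t h hf.hasFDerivWithinAt.hasMFDerivWithinAt hs
  refine h2.congr_mfderiv ?_
  refine ContinuousLinearMap.ext fun (a : ℝ) => ?_
  exact mul_smul a c w

/-- The chain rule for a function along a curve. -/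
theorem HasVelocityWithinAt.hasDerivWithinAt_comp {γ : ℝ → M} {w : E} {s : Set ℝ} {t : ℝ}
    (h : HasVelocityWithinAt γ w s t) {f : M → ℝ}
    (hf : MDifferentiableAt 𝓘(ℝ, E) 𝓘(ℝ, ℝ) f (γ t)) :
    HasDerivWithinAt (fun r => f (γ r)) (mvfderiv 𝓘(ℝ, E) f (γ t) w) s t := by
  have h2 : HasFDerivWithinAt (fun r => f (γ r)) (show ℝ →L[ℝ] ℝ from _) s t :=
    (HasMFDerivAt.comp_hasMFDerivWithinAt t hf.hasMFDerivAt h).hasFDerivWithinAt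
  refine h2.hasDerivWithinAt.congr_deriv ?_
  exact congrArg (mfderiv 𝓘(ℝ, E) 𝓘(ℝ, ℝ) f (γ t)) (one_smul ℝ w)

variable [RiemannianBundle (fun x : M => TangentSpace 𝓘(ℝ, E) x)]

theorem HasVelocityWithinAt.velocity_eq {γ : ℝ → M} {w : E} {t : ℝ}
    (h : HasVelocityWithinAt γ w (Icc 0 1) t) (ht : t ∈ Icc (0 : ℝ) 1) :
    (velocity γ t : E) = w := by
  have hu : UniqueMDiffWithinAt 𝓘(ℝ, ℝ) (Icc (0 : ℝ) 1) t :=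
    (uniqueDiffOn_Icc zero_lt_one t ht).uniqueMDiffWithinAt
  have h2 := HasMFDerivWithinAt.mfderivWithin h hu
  refine (congrArg (fun L : TangentSpace 𝓘(ℝ, ℝ) t →L[ℝ] TangentSpace 𝓘(ℝ, E) (γ t) =>
    L (1 : ℝ)) h2).trans ?_
  exact one_smul ℝ w

theorem hasVelocityWithinAt_velocity {γ : ℝ → M} {t : ℝ}
    (h : MDifferentiableWithinAt 𝓘(ℝ, ℝ) 𝓘(ℝ, E) γ (Icc 0 1) t) :
    HasVelocityWithinAt (E := E) γ (velocity γ t) (Icc 0 1) t := by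
  refine h.hasMFDerivWithinAt.congr_mfderiv ?_
  refine ContinuousLinearMap.ext fun (c : ℝ) => ?_
  have h1 := map_smul (mfderivWithin 𝓘(ℝ, ℝ) 𝓘(ℝ, E) γ (Icc 0 1) t) c (1 : ℝ)
  refine Eq.trans ?_ h1
  exact congrArg (mfderivWithin 𝓘(ℝ, ℝ) 𝓘(ℝ, E) γ (Icc 0 1) t) (mul_one c).symm

end Velocity

/-! ### Geodesics with a velocity field: reparametrization, gluing, regularity, length. -/

section Geodesics

variable {E : Type*} [NormedAddCommGroup E] [NormedSpace ℝ E] [FiniteDimensional ℝ E]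
  {M : Type*} [MetricSpace M] [ChartedSpace E M] [IsManifold 𝓘(ℝ, E) ∞ M]
  [RiemannianBundle (fun x : M => TangentSpace 𝓘(ℝ, E) x)]
  {cov : CovariantDerivative 𝓘(ℝ, E) E (TangentSpace 𝓘(ℝ, E) : M → Type _)}

variable (cov) in
/-- `γ` is a geodesic with velocity field `v` on the set `s` of times. -/
structure GeodesicOn (γ : ℝ → M) (v : ℝ → E) (s : Set ℝ) : Prop where
  hasVelocity : ∀ t ∈ s, HasVelocityWithinAt γ (v t) s t
  parallel : ParallelOn cov γ v v s

variable {γ γ' : ℝ → M} {v v' V V' : ℝ → E} {s s' : Set ℝ}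

theorem ParallelOn.congr (h : ParallelOn cov γ v V s) (hγ : EqOn γ' γ s) (hv : EqOn v' v s)
    (hV : EqOn V' V s) : ParallelOn cov γ' v' V' s := by
  intro t ht W hW
  have hγt := hγ ht
  -- Tangent spaces depend on the base point, so `γ' t = γ t` is used by substitution for a generic
  -- point `q`.
  have key : ∀ q : M, q = γ t → MDifferentiableAt 𝓘(ℝ, E) (𝓘(ℝ, E).prod 𝓘(ℝ, E))
      (fun p => (⟨p, W p⟩ : TangentBundle 𝓘(ℝ, E) M)) q → ∀ a b : E, a = V t → b = v t →
      HasDerivWithinAt (fun r => tinner E (γ r) (V r) (W (γ r)))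
        (tinner E q a (cov W q b)) s t := by
    rintro q rfl hq a b rfl rfl
    exact h t ht W hq
  refine (key (γ' t) hγt hW (V' t) (v' t) (hV ht) (hv ht)).congr_of_mem (fun r hr => ?_) ht
  have hr1 := hγ hr
  have hr2 := hV hr
  have key2 : ∀ (q : M) (a : E), q = γ r → a = V r →
      tinner E q a (W q) = tinner E (γ r) (V r) (W (γ r)) := by
    rintro q a rfl rfl; rfl
  exact key2 _ _ hr1 hr2

theorem GeodesicOn.continuousOn (h : GeodesicOn cov γ v s) : ContinuousOn γ s :=
  fun t ht => (h.hasVelocity t ht).continuousWithinAt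

theorem GeodesicOn.congr (h : GeodesicOn cov γ v s) (hγ : EqOn γ' γ s) (hv : EqOn v' v s) :
    GeodesicOn cov γ' v' s :=
  ⟨fun t ht => by rw [hv ht]; exact (h.hasVelocity t ht).congr hγ ht, h.parallel.congr hγ hv hv⟩

/-- An affine reparametrization of a geodesic is a geodesic. -/
theorem GeodesicOn.comp_affine (h : GeodesicOn cov γ v s) (c d : ℝ)
    (hs : MapsTo (fun t => c * t + d) s' s) :
    GeodesicOn cov (fun t => γ (c * t + d)) (fun t => c • v (c * t + d)) s' := by
  have hd : ∀ t, HasDerivWithinAt (fun t => c * t + d) c s' t := fun t => by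
    simpa using ((hasDerivWithinAt_id t s').const_mul c).add_const d
  refine ⟨fun t ht =>
    HasVelocityWithinAt.comp (f := fun t => c * t + d) (h.hasVelocity _ (hs ht)) (hd t) hs, fun t ht W hW => ?_⟩
  have h1 := (h.parallel _ (hs ht) W hW).scomp t (hd t) hs
  have h2 := h1.const_mul c
  refine (h2.congr_of_mem (fun r _ => ?_) ht).congr_deriv ?_
  · exact tinner_smul_left _ _ _ _
  · refine Eq.symm ((tinner_smul_left _ _ _ _).trans (congrArg (c * ·) ?_))
    refine (congrArg (tinner E _ (v (c * t + d))) (map_smul (cov W (γ (c * t + d))) c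
      (show TangentSpace 𝓘(ℝ, E) (γ (c * t + d)) from v (c * t + d)))).trans ?_
    exact tinner_smul_right _ _ _ _

/-- Two geodesics that fit together to first order form a geodesic. -/
theorem GeodesicOn.union_Icc {a b c : ℝ} (h : GeodesicOn cov γ v (Icc a b))
    (h' : GeodesicOn cov γ v (Icc b c)) : GeodesicOn cov γ v (Icc a c) := by
  -- Away from `b` one piece is a neighbourhood of `t` within the whole interval; at `b` the two
  -- one-sided derivatives agree and combine.
  have key : ∀ t ∈ Icc a c, (t ∈ Icc a b ∧ Icc a b ∈ 𝓝[Icc a c] t) ∨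
      (t ∈ Icc b c ∧ Icc b c ∈ 𝓝[Icc a c] t) ∨ (t ∈ Icc a b ∧ t ∈ Icc b c) := by
    intro t ht
    rcases lt_trichotomy t b with htb | rfl | htb
    · refine Or.inl ⟨⟨ht.1, htb.le⟩, ?_⟩
      filter_upwards [self_mem_nhdsWithin, mem_nhdsWithin_of_mem_nhds (Iio_mem_nhds htb)]
        with r hr hr' using ⟨hr.1, le_of_lt hr'⟩
    · exact Or.inr (Or.inr ⟨⟨ht.1, le_rfl⟩, ⟨le_rfl, ht.2⟩⟩)
    · refine Or.inr (Or.inl ⟨⟨htb.le, ht.2⟩, ?_⟩)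
      filter_upwards [self_mem_nhdsWithin, mem_nhdsWithin_of_mem_nhds (Ioi_mem_nhds htb)]
        with r hr hr' using ⟨le_of_lt hr', hr.2⟩
  have hsub : Icc a c ⊆ Icc a b ∪ Icc b c := fun t ht => by
    rcases le_total t b with htb | htb
    · exact Or.inl ⟨ht.1, htb⟩
    · exact Or.inr ⟨htb, ht.2⟩
  refine ⟨fun t ht => ?_, fun t ht W hW => ?_⟩
  · rcases key t ht with ⟨h1, h2⟩ | ⟨h1, h2⟩ | ⟨h1, h2⟩
    · exact (h.hasVelocity t h1).mono_of_mem_nhdsWithin h2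
    · exact (h'.hasVelocity t h1).mono_of_mem_nhdsWithin h2
    · exact ((h.hasVelocity t h1).union (h'.hasVelocity t h2)).mono hsub
  · rcases key t ht with ⟨h1, h2⟩ | ⟨h1, h2⟩ | ⟨h1, h2⟩
    · exact (h.parallel t h1 W hW).mono_of_mem_nhdsWithin h2
    · exact (h'.parallel t h1 W hW).mono_of_mem_nhdsWithin h2
    · exact ((h.parallel t h1 W hW).union (h'.parallel t h2 W hW)).mono hsub

theorem GeodesicOn.restrict (h : GeodesicOn cov γ v (Icc 0 1)) {η : ℝ}
    (hη : η ∈ Icc (0 : ℝ) 1) :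
    GeodesicOn cov (fun t => γ (η * t)) (fun t => η • v (η * t)) (Icc 0 1) := by
  have := h.comp_affine (s' := Icc 0 1) η 0 fun t ht => by
    simp only [add_zero]
    exact ⟨mul_nonneg hη.1 ht.1, mul_le_one₀ hη.2 ht.1 ht.2⟩
  simpa only [add_zero] using this

variable [IsContMDiffRiemannianBundle 𝓘(ℝ, E) ∞ E (fun x : M => TangentSpace 𝓘(ℝ, E) x)]

theorem IsGeodesic.geodesicOn (h : IsGeodesic cov γ) :
    GeodesicOn cov γ (fun t => velocity γ t) (Icc 0 1) :=
  ⟨fun t ht => hasVelocityWithinAt_velocity ((h.1 t ht).mdifferentiableWithinAt one_ne_zero), h.2⟩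

/-- `GeodesicOn` does not demand a continuous velocity, but parallelism makes its components in an
orthonormal frame differentiable, hence continuous. Since the frame is smooth in the chart, the
chart derivative of the curve is continuous. -/
theorem GeodesicOn.contMDiffOn (h : GeodesicOn cov γ v s) :
    ContMDiffOn 𝓘(ℝ, ℝ) 𝓘(ℝ, E) 1 γ s := by
  intro t ht
  obtain ⟨W, u, hu, hW⟩ := exists_isOrthonormalFrameOn (E := E) (γ t)
  set p := γ t
  have hps : p ∈ (chartAt E p).source := mem_chart_source E p
  rw [contMDiffWithinAt_iff_target_of_mem_source hps]
  refine ⟨h.continuousOn t ht, ?_⟩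
  rw [contMDiffWithinAt_iff_contDiffWithinAt]
  set O := (chartAt E p).source ∩ u
  have hO : IsOpen O := (chartAt E p).open_source.inter hW.isOpen
  have hsub : s ∩ γ ⁻¹' O ⊆ s := inter_subset_left
  have hmem : s ∩ γ ⁻¹' O ∈ 𝓝[s] t :=
    inter_mem self_mem_nhdsWithin (h.continuousOn t ht (hO.mem_nhds ⟨hps, hu⟩))
  rw [← zero_add (1 : WithTop ℕ∞), contDiffWithinAt_succ_iff_hasFDerivWithinAt (by simp)]
  refine ⟨s ∩ γ ⁻¹' O, by rwa [insert_eq_of_mem ht], by simp, fun r =>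
    ContinuousLinearMap.toSpanSingleton ℝ (chartVec p (γ r) (v r)), fun r hr => ?_, ?_⟩
  · exact (((h.hasVelocity r hr.1).chart hr.2.1).mono hsub).hasFDerivWithinAt
  · rw [contDiffWithinAt_zero (show t ∈ s ∩ γ ⁻¹' O from ⟨ht, hps, hu⟩)]
    refine ⟨univ, univ_mem, ?_⟩
    rw [inter_univ]
    refine (ContinuousLinearMap.toSpanSingletonCLE (𝕜 := ℝ) (E := E)).continuous.comp_continuousOn ?_
    have he : EqOn (fun r => chartVec p (γ r) (v r))
        (fun r => ∑ i, tinner E (γ r) (v r) (W i (γ r)) • chartVec (E := E) p (γ r) (W i (γ r)))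
        (s ∩ γ ⁻¹' O) := by
      intro r hr
      have := hW.sum_eq hr.2.2 (v r)
      refine (congrArg (chartVec p (γ r)) this).trans ?_
      exact chartVec_sum _ _ _ _ _
    refine ContinuousOn.congr ?_ he
    refine continuousOn_finsetSum _ fun i _ => ContinuousOn.smul ?_ ?_
    · exact fun r hr => (((h.parallel r hr.1 (W i) (hW.mdifferentiableAt i _)).mono
        hsub).continuousWithinAt)
    · exact (contMDiffOn_chartVec p (hW.contMDiff i)).continuousOn.comp
        (h.continuousOn.mono hsub) fun r hr => hr.2.1

theorem GeodesicOn.velocity_eq (h : GeodesicOn cov γ v (Icc 0 1)) {t : ℝ}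
    (ht : t ∈ Icc (0 : ℝ) 1) : (velocity γ t : E) = v t :=
  (h.hasVelocity t ht).velocity_eq ht

theorem GeodesicOn.isGeodesic (h : GeodesicOn cov γ v (Icc 0 1)) : IsGeodesic cov γ := by
  refine ⟨h.contMDiffOn, ?_⟩
  exact h.parallel.congr (fun _ _ => rfl) (fun t ht => h.velocity_eq ht)
    (fun t ht => h.velocity_eq ht)

theorem GeodesicOn.tnorm_eq (hcov : IsLeviCivita cov) (h : GeodesicOn cov γ v (Icc 0 1)) {t : ℝ}
    (ht : t ∈ Icc (0 : ℝ) 1) : tnorm E (γ t) (v t) = tnorm E (γ 0) (v 0) := by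
  have := ParallelOn.tinner_eq hcov h.continuousOn h.parallel h.parallel ht
  rw [tinner_self, tinner_self] at this
  exact (sq_eq_sq₀ (tnorm_nonneg _ _) (tnorm_nonneg _ _)).1 this

/-- The speed is constant on a parameter interval of length 1. -/
theorem GeodesicOn.pathELength_eq (hcov : IsLeviCivita cov)
    (h : GeodesicOn cov γ v (Icc 0 1)) :
    pathELength 𝓘(ℝ, E) γ 0 1 = ENNReal.ofReal (tnorm E (γ 0) (v 0)) := by
  rw [pathELength_eq_lintegral_mfderivWithin_Icc]
  have : ∀ t ∈ Icc (0 : ℝ) 1, ‖mfderivWithin 𝓘(ℝ, ℝ) 𝓘(ℝ, E) γ (Icc 0 1) t (1 : ℝ)‖ₑ =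
      ENNReal.ofReal (tnorm E (γ 0) (v 0)) := by
    intro t ht
    rw [← h.tnorm_eq hcov ht, ← ofReal_norm]
    exact congrArg ENNReal.ofReal (congrArg (tnorm E (γ t)) (h.velocity_eq ht))
  refine (MeasureTheory.setLIntegral_congr_fun measurableSet_Icc this).trans ?_
  simp

variable [IsRiemannianManifold 𝓘(ℝ, E) M]

theorem GeodesicOn.dist_le_one (hcov : IsLeviCivita cov) (h : GeodesicOn cov γ v (Icc 0 1)) :
    dist (γ 0) (γ 1) ≤ tnorm E (γ 0) (v 0) := by
  have h1 := riemannianEDist_le_pathELength h.contMDiffOn rfl rfl zero_le_one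
  rw [← IsRiemannianManifold.out (I := 𝓘(ℝ, E)) (γ 0) (γ 1), h.pathELength_eq hcov,
    edist_dist] at h1
  exact (ENNReal.ofReal_le_ofReal_iff (tnorm_nonneg _ _)).1 h1

theorem GeodesicOn.dist_le (hcov : IsLeviCivita cov) (h : GeodesicOn cov γ v (Icc 0 1)) {t : ℝ}
    (ht : t ∈ Icc (0 : ℝ) 1) : dist (γ 0) (γ t) ≤ t * tnorm E (γ 0) (v 0) := by
  have := (h.restrict ht).dist_le_one hcov
  simpa [tnorm_smul, abs_of_nonneg ht.1] using this

end Geodesics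

/-! ### Local existence of geodesics, uniform on compact sets. -/

section Existence

open Metric

/-- Uniform local existence for an autonomous `C¹` differential equation, with solutions confined to
a given neighbourhood. -/
theorem exists_forall_mem_closedBall_hasDerivWithinAt_mem {G : Type*} [NormedAddCommGroup G]
    [NormedSpace ℝ G] [CompleteSpace G] {F : G → G} {x₀ : G} (hF : ContDiffAt ℝ 1 F x₀)
    {O : Set G} (hO : O ∈ 𝓝 x₀) :
    ∃ r > (0 : ℝ), ∃ ε > (0 : ℝ), ∀ x ∈ closedBall x₀ r, ∃ α : ℝ → G, α 0 = x ∧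
      ∀ t ∈ Icc 0 ε, HasDerivWithinAt α (F (α t)) (Icc 0 ε) t ∧ α t ∈ O := by
  obtain ⟨ε, hε, a, r, L, K, hr, hpl⟩ := IsPicardLindelof.of_contDiffAt_one hF
  obtain ⟨α, hα, hc⟩ := (hpl 0).exists_forall_mem_closedBall_eq_hasDerivWithinAt_continuousOn
  have hr' : (0 : ℝ) < r := hr
  have h0 : α (x₀, 0) = x₀ := (hα x₀ (mem_closedBall_self hr'.le)).1
  have hmem : ((x₀, 0) : G × ℝ) ∈ closedBall x₀ (r : ℝ) ×ˢ Icc (0 - ε) (0 + ε) :=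
    ⟨mem_closedBall_self hr'.le, by constructor <;> linarith⟩
  -- The flow is jointly continuous and equals `x₀` at `(x₀, 0)`, so nearby starts stay in `O` for a
  -- short common time.
  have h1 : ∀ᶠ z in 𝓝[closedBall x₀ (r : ℝ) ×ˢ Icc (0 - ε) (0 + ε)] (x₀, (0 : ℝ)), α z ∈ O :=
    (hc _ hmem).eventually (by rwa [h0])
  obtain ⟨δ, hδ, h2⟩ := Metric.mem_nhdsWithin_iff.1 h1
  refine ⟨min (r : ℝ) (δ / 2), by positivity, min ε (δ / 2), by positivity, fun x hx => ?_⟩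
  have hxr : x ∈ closedBall x₀ (r : ℝ) := closedBall_subset_closedBall (min_le_left _ _) hx
  have hsub : Icc 0 (min ε (δ / 2)) ⊆ Icc (0 - ε) (0 + ε) := fun t ht =>
    ⟨by linarith [ht.1], by linarith [ht.2.trans (min_le_left _ _)]⟩
  refine ⟨fun t => α (x, t), (hα x hxr).1, fun t ht => ⟨((hα x hxr).2 t (hsub ht)).mono hsub, ?_⟩⟩
  refine h2 ⟨?_, hxr, hsub ht⟩
  rw [mem_ball, Prod.dist_eq, max_lt_iff]
  constructor
  · have := (mem_closedBall.1 hx).trans (min_le_right _ _)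
    dsimp only; linarith
  · have := ht.2.trans (min_le_right _ _)
    simp only [Real.dist_eq, sub_zero, abs_of_nonneg ht.1]; linarith

variable {E : Type*} [NormedAddCommGroup E] [NormedSpace ℝ E] [FiniteDimensional ℝ E]
  {M : Type*} [MetricSpace M] [ChartedSpace E M] [IsManifold 𝓘(ℝ, E) ∞ M]
  [RiemannianBundle (fun x : M => TangentSpace 𝓘(ℝ, E) x)]
  [IsContMDiffRiemannianBundle 𝓘(ℝ, E) ∞ E (fun x : M => TangentSpace 𝓘(ℝ, E) x)]
  {cov : CovariantDerivative 𝓘(ℝ, E) E (TangentSpace 𝓘(ℝ, E) : M → Type _)}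

/-- Parallelism can be tested on a local orthonormal frame. -/
theorem hasDerivWithinAt_tinner_of_frame (hcov : IsLeviCivita cov) {n : ℕ}
    {W : Fin n → ∀ x : M, TangentSpace 𝓘(ℝ, E) x} {u : Set M} (hW : IsOrthonormalFrameOn W u)
    {γ : ℝ → M} {V : ℝ → E} {w : E} {s : Set ℝ} {t : ℝ} (hu : γ t ∈ u)
    (hγ : HasVelocityWithinAt γ w s t)
    (hV : ∀ i, HasDerivWithinAt (fun r => tinner E (γ r) (V r) (W i (γ r)))
      (tinner E (γ t) (V t) (cov (W i) (γ t) w)) s t)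
    {U : ∀ p : M, TangentSpace 𝓘(ℝ, E) p}
    (hU : MDifferentiableAt 𝓘(ℝ, E) (𝓘(ℝ, E).prod 𝓘(ℝ, E))
      (fun p => (⟨p, U p⟩ : TangentBundle 𝓘(ℝ, E) M)) (γ t)) :
    HasDerivWithinAt (fun r => tinner E (γ r) (V r) (U (γ r)))
      (tinner E (γ t) (V t) (cov U (γ t) w)) s t := by
  have hf : ∀ i, HasDerivWithinAt (fun r => tinner E (γ r) (U (γ r)) (W i (γ r)))
      (tinner E (γ t) (cov U (γ t) w) (W i (γ t)) +
        tinner E (γ t) (U (γ t)) (cov (W i) (γ t) w)) s t := fun i => by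
    have hd : MDifferentiableAt 𝓘(ℝ, E) 𝓘(ℝ, ℝ) (fun p => tinner E p (U p) (W i p)) (γ t) :=
      MDifferentiableAt.inner_bundle (E := (TangentSpace 𝓘(ℝ, E) : M → Type _)) hU
        (hW.mdifferentiableAt i _)
    exact (hγ.hasDerivWithinAt_comp hd).congr_deriv
      (hcov.mvfderiv_tinner hU (hW.mdifferentiableAt i _) w)
  have hd := HasDerivWithinAt.fun_sum (u := Finset.univ) fun i _ => (hV i).mul (hf i)
  have he : ∀ᶠ r in 𝓝[s] t, tinner E (γ r) (V r) (U (γ r)) =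
      ∑ i, tinner E (γ r) (V r) (W i (γ r)) * tinner E (γ r) (U (γ r)) (W i (γ r)) := by
    filter_upwards [hγ.continuousWithinAt.eventually (hW.isOpen.mem_nhds hu)] with r hr
    exact hW.tinner_eq hr _ _
  refine (hd.congr_of_eventuallyEq he (hW.tinner_eq hu _ _)).congr_deriv ?_
  -- The terms containing derivatives of the frame cancel; what remains is the frame expansion of
  -- `⟪V, ∇_w U⟫`.
  have h1 := hcov.sum_skew hW hu w (V t) (U (γ t))
  have h2 := hW.tinner_eq hu (V t) (cov U (γ t) w)
  refine Eq.trans ?_ (h2.symm)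
  refine Eq.trans ?_ ((congrArg (· + _) h1).trans (zero_add _))
  refine Eq.trans ?_ Finset.sum_add_distrib
  refine Finset.sum_congr rfl fun i _ => ?_
  ring

/-- These are the coefficients of the geodesic equation; their smoothness allows Picard-Lindelöf to
be applied. -/
theorem contMDiff_connectionCoeff (hcov : IsLeviCivita cov)
    {A B C : ∀ x : M, TangentSpace 𝓘(ℝ, E) x}
    (hA : ContMDiff 𝓘(ℝ, E) (𝓘(ℝ, E).prod 𝓘(ℝ, E)) ∞
      (fun x => (⟨x, A x⟩ : TangentBundle 𝓘(ℝ, E) M)))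
    (hB : ContMDiff 𝓘(ℝ, E) (𝓘(ℝ, E).prod 𝓘(ℝ, E)) ∞
      (fun x => (⟨x, B x⟩ : TangentBundle 𝓘(ℝ, E) M)))
    (hC : ContMDiff 𝓘(ℝ, E) (𝓘(ℝ, E).prod 𝓘(ℝ, E)) ∞
      (fun x => (⟨x, C x⟩ : TangentBundle 𝓘(ℝ, E) M))) :
    ContMDiff 𝓘(ℝ, E) 𝓘(ℝ, ℝ) ∞ (fun x => tinner E x (A x) (cov B x (C x))) := by
  have h1 := hcov.smooth.contMDiff.contMDiff (σ := B) hB.contMDiffOn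
  have h2 : ContMDiffOn 𝓘(ℝ, E) (𝓘(ℝ, E).prod 𝓘(ℝ, E)) ∞
      (fun x => (⟨x, cov B x (C x)⟩ : TangentBundle 𝓘(ℝ, E) M)) univ :=
    ContMDiffOn.clm_bundle_apply (E₁ := (TangentSpace 𝓘(ℝ, E) : M → Type _))
      (E₂ := (TangentSpace 𝓘(ℝ, E) : M → Type _)) h1 hC.contMDiffOn
  exact contMDiffOn_univ.1 (contMDiffOn_inner hA.contMDiffOn h2)

/-- Around every point, geodesics with small initial velocity exist up to time `1`. -/
theorem exists_geodesicOn_of_tnorm_lt (hcov : IsLeviCivita cov) (p : M) :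
    ∃ δ > 0, ∀ᶠ q in 𝓝 p, ∀ w : E, tnorm E q w < δ →
      ∃ (γ : ℝ → M) (v : ℝ → E), GeodesicOn cov γ v (Icc 0 1) ∧ γ 0 = q ∧ v 0 = w := by
  obtain ⟨W, u, hu, hW⟩ := exists_isOrthonormalFrameOn (E := E) p
  let χ := extChartAt 𝓘(ℝ, E) p
  let wc : Fin (Module.finrank ℝ E) → E → E := fun k y => chartVec p (χ.symm y) (W k (χ.symm y))
  let cc : Fin (Module.finrank ℝ E) → Fin (Module.finrank ℝ E) → Fin (Module.finrank ℝ E) → E → ℝ := fun j k i y =>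
    tinner E (χ.symm y) (W j (χ.symm y)) (cov (W i) (χ.symm y) (W k (χ.symm y)))
  -- The geodesic equation as a first-order system. The unknowns are the position `y` in the chart
  -- and the frame components `a` of the velocity: `y' = ∑ a_k W_k` and `a_i' = ⟪v, ∇_v W_i⟫ = ∑ a_j
  -- a_k ⟪W_j, ∇_{W_k} W_i⟫`.
  let F : E × (Fin (Module.finrank ℝ E) → ℝ) → E × (Fin (Module.finrank ℝ E) → ℝ) := fun z =>
    (∑ k, z.2 k • wc k z.1, fun i => ∑ j, ∑ k, z.2 j * z.2 k * cc j k i z.1)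
  have htarget : χ.target ∈ 𝓝 (χ p) := extChartAt_target_mem_nhds p
  have hsymm : ContMDiffOn 𝓘(ℝ, E) 𝓘(ℝ, E) ∞ χ.symm χ.target := contMDiffOn_extChartAt_symm p
  have hsource : ∀ y ∈ χ.target, χ.symm y ∈ (chartAt E p).source := fun y hy => by
    have := χ.map_target hy
    rwa [extChartAt_source] at this
  have h1inf : (1 : WithTop ℕ∞) ≤ ∞ := by exact_mod_cast le_top
  have hwc : ∀ k, ContDiffAt ℝ 1 (wc k) (χ p) := fun k =>
    ((contMDiffOn_iff_contDiffOn.1 ((contMDiffOn_chartVec p (hW.contMDiff k)).comp hsymm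
      hsource)).contDiffAt htarget).of_le h1inf
  have hcc : ∀ j k i, ContDiffAt ℝ 1 (cc j k i) (χ p) := fun j k i =>
    ((contMDiffOn_iff_contDiffOn.1 ((contMDiff_connectionCoeff hcov (hW.contMDiff j)
      (hW.contMDiff i) (hW.contMDiff k)).comp_contMDiffOn hsymm)).contDiffAt htarget).of_le h1inf
  have hsnd : ∀ k, ContDiffAt ℝ 1 (fun z : E × (Fin (Module.finrank ℝ E) → ℝ) => z.2 k) (χ p, 0) := fun k =>
    (contDiffAt_pi.1 contDiffAt_snd) k
  have hF : ContDiffAt ℝ 1 F (χ p, 0) := by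
    refine ContDiffAt.prodMk (ContDiffAt.sum fun k _ => (hsnd k).smul ?_)
      (contDiffAt_pi.2 fun i => ContDiffAt.sum fun j _ => ContDiffAt.sum fun k _ =>
        ((hsnd j).mul (hsnd k)).mul ?_)
    · exact ContDiffAt.comp (χ p, (0 : Fin (Module.finrank ℝ E) → ℝ)) (hwc k) contDiffAt_fst
    · exact ContDiffAt.comp (χ p, (0 : Fin (Module.finrank ℝ E) → ℝ)) (hcc j k i) contDiffAt_fst
  have hcont : ContinuousAt χ.symm (χ p) := continuousAt_extChartAt_symm p
  have hpp : χ.symm (χ p) = p := extChartAt_to_inv p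
  have hO : {z : E × (Fin (Module.finrank ℝ E) → ℝ) | z.1 ∈ χ.target ∧ χ.symm z.1 ∈ u} ∈
      𝓝 (χ p, (0 : Fin (Module.finrank ℝ E) → ℝ)) := by
    have h1 : ∀ᶠ y in 𝓝 (χ p), y ∈ χ.target ∧ χ.symm y ∈ u :=
      Filter.Eventually.and htarget (hcont.eventually (by rw [hpp]; exact hW.isOpen.mem_nhds hu))
    exact (continuousAt_fst (p := (χ p, (0 : Fin (Module.finrank ℝ E) → ℝ)))).eventually h1
  obtain ⟨ρ, hρ, ε, hε, hsol⟩ := exists_forall_mem_closedBall_hasDerivWithinAt_mem hF hO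
  -- Solutions live on `[0, ε]` for initial velocities of norm at most `ρ`; stretching time to `[0,
  -- 1]` multiplies velocities by `ε`.
  refine ⟨ε * ρ, by positivity, ?_⟩
  have hnear : ∀ᶠ q in 𝓝 p, q ∈ χ.source ∧ q ∈ u ∧ χ q ∈ closedBall (χ p) ρ :=
    Filter.Eventually.and (extChartAt_source_mem_nhds p) (Filter.Eventually.and
      (hW.isOpen.mem_nhds hu)
      ((continuousAt_extChartAt p).eventually (closedBall_mem_nhds _ hρ)))
  filter_upwards [hnear] with q hq w hw
  set w' : E := ε⁻¹ • w
  have hw' : tnorm E q w' ≤ ρ := by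
    rw [tnorm_smul, abs_of_pos (inv_pos.2 hε), inv_mul_le_iff₀ hε]
    exact hw.le
  let a₀ : Fin (Module.finrank ℝ E) → ℝ := fun i => tinner E q w' (W i q)
  have ha₀ : (χ q, a₀) ∈ closedBall (χ p, (0 : Fin (Module.finrank ℝ E) → ℝ)) ρ := by
    rw [mem_closedBall, Prod.dist_eq, max_le_iff]
    refine ⟨hq.2.2, ?_⟩
    rw [dist_zero_right, pi_norm_le_iff_of_nonneg hρ.le]
    -- Cauchy-Schwarz against a unit vector bounds each frame component by the norm.
    intro i
    refine le_trans ?_ hw'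
    have h1 := abs_real_inner_le_norm (show TangentSpace 𝓘(ℝ, E) q from w') (W i q)
    refine h1.trans_eq ?_
    exact (congrArg (tnorm E q w' * ·) ((hW.orthonormal q hq.2.1).1 i)).trans (mul_one _)
  obtain ⟨α, hα0, hα⟩ := hsol _ ha₀
  let γ : ℝ → M := fun t => χ.symm (α t).1
  let v : ℝ → E := fun t => ∑ k, (α t).2 k • (show E from W k (γ t))
  have hvW : ∀ t ∈ Icc 0 ε, ∀ i, tinner E (γ t) (v t) (W i (γ t)) = (α t).2 i := by
    intro t ht i
    refine (tinner_sum_left _ _ _ _).trans ?_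
    rw [Finset.sum_eq_single i]
    · refine (tinner_smul_left _ _ _ _).trans ?_
      refine (congrArg ((α t).2 i * ·) (hW.tinner_frame (hα t ht).2.2 i i)).trans ?_
      simp
    · intro k _ hk
      refine (tinner_smul_left _ _ _ _).trans ?_
      refine (congrArg ((α t).2 k * ·) (hW.tinner_frame (hα t ht).2.2 k i)).trans ?_
      simp [hk]
    · simp
  have hfst : ∀ t ∈ Icc 0 ε, HasDerivWithinAt (fun t => (α t).1) (F (α t)).1 (Icc 0 ε) t :=
    fun t ht => ((hα t ht).1.hasFDerivWithinAt.fst).hasDerivWithinAt.congr_deriv (by simp)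
  have hsnd' : ∀ t ∈ Icc 0 ε, HasDerivWithinAt (fun t => (α t).2) (F (α t)).2 (Icc 0 ε) t :=
    fun t ht => ((hα t ht).1.hasFDerivWithinAt.snd).hasDerivWithinAt.congr_deriv (by simp)
  have hvel : ∀ t ∈ Icc 0 ε, HasVelocityWithinAt γ (v t) (Icc 0 ε) t := by
    intro t ht
    refine hasVelocityWithinAt_chart_symm (y := fun t => (α t).1) (hα t ht).2.1 ?_
    refine (hfst t ht).congr_deriv ?_
    exact (chartVec_sum Finset.univ p (γ t) (α t).2 fun k => (show E from W k (γ t))).symm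
  have hgeo : GeodesicOn cov γ v (Icc 0 ε) := by
    refine ⟨hvel, fun t ht U hU => ?_⟩
    refine hasDerivWithinAt_tinner_of_frame hcov hW (hα t ht).2.2 (hvel t ht) (fun i => ?_) hU
    have h1 := (hasDerivWithinAt_pi.1 (hsnd' t ht)) i
    refine (h1.congr_of_mem (fun r hr => hvW r hr i) ht).congr_deriv ?_
    refine Eq.symm ((tinner_sum_left _ _ _ _).trans (Finset.sum_congr rfl fun j _ => ?_))
    refine (tinner_smul_left _ _ _ _).trans ?_
    have h2 : (cov (W i) (γ t) (v t) : E) =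
        ∑ k, (α t).2 k • (show E from cov (W i) (γ t) (W k (γ t))) := by
      refine (map_sum (cov (W i) (γ t))
        (fun k => (show TangentSpace 𝓘(ℝ, E) (γ t) from (α t).2 k • W k (γ t))) Finset.univ).trans
        (Finset.sum_congr rfl fun k _ => ?_)
      exact map_smul (cov (W i) (γ t)) ((α t).2 k) (W k (γ t))
    refine (congrArg (fun e => (α t).2 j * tinner E (γ t) (W j (γ t)) e) h2).trans ?_
    refine (congrArg ((α t).2 j * ·) (tinner_sum_right _ _ _ _)).trans ?_
    rw [Finset.mul_sum]
    refine Finset.sum_congr rfl fun k _ => ?_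
    refine (congrArg ((α t).2 j * ·) (tinner_smul_right _ _ _ _)).trans ?_
    exact (mul_assoc _ _ _).symm
  have hγ0 : γ 0 = q := by
    have : (α 0).1 = χ q := congrArg Prod.fst hα0
    exact (congrArg χ.symm this).trans (χ.left_inv hq.1)
  have hv0 : v 0 = w' := by
    have h1 : (α 0).2 = a₀ := congrArg Prod.snd hα0
    have key : ∀ q' : M, q' = q → ∑ k, a₀ k • (show E from W k q') = w' := by
      rintro q' rfl
      exact (hW.sum_eq hq.2.1 w').symm
    refine Eq.trans ?_ (key (γ 0) hγ0)
    exact Finset.sum_congr rfl fun k _ => by rw [h1]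
  have hfin := hgeo.comp_affine (s' := Icc 0 1) ε 0 fun t ht => by
    simp only [add_zero]
    exact ⟨mul_nonneg hε.le ht.1, mul_le_of_le_one_right hε.le ht.2⟩
  refine ⟨_, _, hfin, ?_, ?_⟩
  · simpa using hγ0
  · simp only [mul_zero, add_zero, hv0, w', smul_smul, mul_inv_cancel₀ hε.ne', one_smul]

/-- On a compact set, geodesics with small initial velocity exist up to time `1`, uniformly. -/
theorem exists_forall_geodesicOn_of_tnorm_lt (hcov : IsLeviCivita cov) {X : Set M}
    (hX : IsCompact X) :
    ∃ δ > 0, ∀ q ∈ X, ∀ w : E, tnorm E q w < δ →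
      ∃ (γ : ℝ → M) (v : ℝ → E), GeodesicOn cov γ v (Icc 0 1) ∧ γ 0 = q ∧ v 0 = w := by
  refine hX.induction_on (p := fun S => ∃ δ > 0, ∀ q ∈ S, ∀ w : E, tnorm E q w < δ →
      ∃ (γ : ℝ → M) (v : ℝ → E), GeodesicOn cov γ v (Icc 0 1) ∧ γ 0 = q ∧ v 0 = w)
    ⟨1, one_pos, by simp⟩ ?_ ?_ ?_
  · rintro S T hST ⟨δ, hδ, h⟩
    exact ⟨δ, hδ, fun q hq => h q (hST hq)⟩
  · rintro S T ⟨δ, hδ, h⟩ ⟨δ', hδ', h'⟩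
    refine ⟨min δ δ', lt_min hδ hδ', ?_⟩
    rintro q (hq | hq) w hw
    · exact h q hq w (hw.trans_le (min_le_left _ _))
    · exact h' q hq w (hw.trans_le (min_le_right _ _))
  · intro p _
    obtain ⟨δ, hδ, h⟩ := exists_geodesicOn_of_tnorm_lt hcov p
    exact ⟨_, mem_nhdsWithin_of_mem_nhds h, δ, hδ, fun q hq => hq⟩

end Existence

/-! ### The geodesic map and inverse exponential of a g-convex set. -/

section GConvexity

variable {E : Type*} [NormedAddCommGroup E] [NormedSpace ℝ E] [FiniteDimensional ℝ E]
  {M : Type*} [MetricSpace M] [ChartedSpace E M] [IsManifold 𝓘(ℝ, E) ∞ M]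
  [RiemannianBundle (fun x : M => TangentSpace 𝓘(ℝ, E) x)]
  [IsContMDiffRiemannianBundle 𝓘(ℝ, E) ∞ E (fun x : M => TangentSpace 𝓘(ℝ, E) x)]
  {cov : CovariantDerivative 𝓘(ℝ, E) E (TangentSpace 𝓘(ℝ, E) : M → Type _)}
  {X : Set M} {x y z : M}

theorem GConvex.isGeodesicIn (hX : GConvex cov X) (hx : x ∈ X) (hy : y ∈ X) :
    IsGeodesicIn cov X x y (geod cov X x y) := by
  obtain ⟨γ, hγ, -, -⟩ := hX x hx y hy
  have h : ∃ γ : ℝ → M, IsGeodesicIn cov X x y γ := ⟨γ, hγ⟩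
  unfold geod
  rw [dif_pos h]
  exact h.choose_spec

theorem GConvex.geod_mem (hX : GConvex cov X) (hx : x ∈ X) (hy : y ∈ X) {t : ℝ}
    (ht : t ∈ Icc (0 : ℝ) 1) : geod cov X x y t ∈ X :=
  (hX.isGeodesicIn hx hy).mem t ht

/-- Geodesics in a g-convex set are determined by their endpoints. -/
theorem GConvex.eqOn_geod (hX : GConvex cov X) {γ : ℝ → M} {v : ℝ → E}
    (hγ : GeodesicOn cov γ v (Icc 0 1)) (hmem : ∀ t ∈ Icc (0 : ℝ) 1, γ t ∈ X) :
    EqOn (geod cov X (γ 0) (γ 1)) γ (Icc 0 1) := by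
  have h0 := hmem 0 (by simp)
  have h1 := hmem 1 (by simp)
  obtain ⟨γ₀, -, -, huniq⟩ := hX _ h0 _ h1
  exact (huniq _ (hX.isGeodesicIn h0 h1)).trans
    (huniq γ ⟨hγ.isGeodesic, rfl, rfl, hmem⟩).symm

theorem GConvex.geodesicOn_geod (hX : GConvex cov X) {γ : ℝ → M} {v : ℝ → E}
    (hγ : GeodesicOn cov γ v (Icc 0 1)) (hmem : ∀ t ∈ Icc (0 : ℝ) 1, γ t ∈ X) :
    GeodesicOn cov (geod cov X (γ 0) (γ 1)) v (Icc 0 1) :=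
  hγ.congr (hX.eqOn_geod hγ hmem) fun _ _ => rfl

variable (cov X) in
/-- The vector `expInv cov X x y`, regarded as an element of the model space. -/
def expVec (x y : M) : E := expInv cov X x y

theorem expVec_eq_velocity : expVec cov X x y = velocity (geod cov X x y) 0 := by
  have key : ∀ {p q : M} (h : p = q) (w : TangentSpace 𝓘(ℝ, E) p),
      ((h ▸ w : TangentSpace 𝓘(ℝ, E) q) : E) = w := by
    rintro p q rfl w; rfl
  exact key (geod_zero cov X x y) _

/-- Uniqueness of geodesics in `X` allows the inverse exponential to be read off any geodesic
staying in `X`. -/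
theorem GConvex.expVec_eq (hX : GConvex cov X) {γ : ℝ → M} {v : ℝ → E}
    (hγ : GeodesicOn cov γ v (Icc 0 1)) (hmem : ∀ t ∈ Icc (0 : ℝ) 1, γ t ∈ X)
    (hx : γ 0 = x) (hy : γ 1 = y) : expVec cov X x y = v 0 := by
  subst hx hy
  exact expVec_eq_velocity.trans ((hX.geodesicOn_geod hγ hmem).velocity_eq (by simp))

/-- The velocity field of the geodesic in `X` from `x` to `y`. -/
theorem GConvex.exists_geodesicOn (hX : GConvex cov X) (hx : x ∈ X) (hy : y ∈ X) :
    ∃ v : ℝ → E, GeodesicOn cov (geod cov X x y) v (Icc 0 1) ∧ v 0 = expVec cov X x y :=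
  ⟨_, (hX.isGeodesicIn hx hy).geodesic.geodesicOn, expVec_eq_velocity.symm⟩

theorem GConvex.geod_one (hX : GConvex cov X) (hx : x ∈ X) (hy : y ∈ X) :
    geod cov X x y 1 = y := (hX.isGeodesicIn hx hy).target

/-- The initial speed is the length of the geodesic, which equals the distance because the geodesic
is minimizing. -/
theorem GConvex.tnorm_expVec (hcov : IsLeviCivita cov) (hX : GConvex cov X) (hx : x ∈ X)
    (hy : y ∈ X) : tnorm E x (expVec cov X x y) = dist x y := by
  obtain ⟨v, hv, hv0⟩ := hX.exists_geodesicOn hx hy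
  obtain ⟨γ₀, -, hlen, huniq⟩ := hX x hx y hy
  have h1 := hv.pathELength_eq hcov
  rw [pathELength_congr (huniq _ (hX.isGeodesicIn hx hy)), hlen, edist_dist,
    ENNReal.ofReal_eq_ofReal_iff dist_nonneg (tnorm_nonneg _ _), geod_zero, hv0] at h1
  exact h1.symm

/-- The initial piece `t ↦ γ(ηt)` is again a geodesic in `X`, with initial velocity scaled by `η`.
-/
theorem GConvex.expVec_geod (hX : GConvex cov X) (hx : x ∈ X) (hz : z ∈ X) {η : ℝ}
    (hη : η ∈ Icc (0 : ℝ) 1) :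
    expVec cov X x (geod cov X x z η) = η • expVec cov X x z := by
  obtain ⟨v, hv, hv0⟩ := hX.exists_geodesicOn hx hz
  rw [← hv0]
  refine (hX.expVec_eq (hv.restrict hη) (fun t ht => hX.geod_mem hx hz
    ⟨mul_nonneg hη.1 ht.1, mul_le_one₀ hη.2 ht.1 ht.2⟩) ?_ ?_).trans ?_
  · rw [mul_zero, geod_zero]
  · rw [mul_one]
  · rw [mul_zero]

theorem GConvex.dist_geod (hcov : IsLeviCivita cov) (hX : GConvex cov X) (hx : x ∈ X)
    (hz : z ∈ X) {η : ℝ} (hη : η ∈ Icc (0 : ℝ) 1) :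
    dist x (geod cov X x z η) = η * dist x z := by
  rw [← hX.tnorm_expVec hcov hx (hX.geod_mem hx hz hη), ← hX.tnorm_expVec hcov hx hz]
  refine (congrArg (tnorm E x) (hX.expVec_geod hx hz hη)).trans ?_
  exact (tnorm_smul _ _ _).trans (congrArg (· * _) (abs_of_nonneg hη.1))

variable [IsRiemannianManifold 𝓘(ℝ, E) M]

/-- Geodesics starting at the center of a metric ball contained in a compact set extend up to the
boundary of the ball. -/
theorem exists_geodesicOn_of_ball_subset (hcov : IsLeviCivita cov) (hX : IsCompact X) {ρ : ℝ}
    (hball : Metric.ball x ρ ⊆ X) (w : E) (hw : tnorm E x w < ρ) :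
    ∃ (γ : ℝ → M) (v : ℝ → E), GeodesicOn cov γ v (Icc 0 1) ∧ γ 0 = x ∧ v 0 = w := by
  have hρ : 0 < ρ := (tnorm_nonneg x w).trans_lt hw
  obtain ⟨δ, hδ, hloc⟩ := exists_forall_geodesicOn_of_tnorm_lt (E := E) hcov hX
  -- Each induction step prolongs the geodesic by one piece of length below `δ`, so velocities of
  -- norm below `n * δ` are reached after `n` pieces.
  suffices H : ∀ n : ℕ, 1 ≤ n → ∀ w : E, tnorm E x w < ρ → tnorm E x w < n * δ →
      ∃ (γ : ℝ → M) (v : ℝ → E), GeodesicOn cov γ v (Icc 0 1) ∧ γ 0 = x ∧ v 0 = w by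
    obtain ⟨n, hn⟩ := exists_nat_gt (tnorm E x w / δ)
    refine H (n + 1) (by simp) w hw ?_
    rw [div_lt_iff₀ hδ] at hn
    push_cast; linarith
  intro n hn
  induction n, hn using Nat.le_induction with
  | base =>
    intro w hw hw'
    exact hloc x (hball (Metric.mem_ball_self hρ)) w (by simpa using hw')
  | succ n hn ih =>
    intro w hw hw'
    have hn0 : (0 : ℝ) < n := by exact_mod_cast hn
    -- The first `n/N` of the geodesic is, up to rescaling, the one with velocity `(n/N) w` given by
    -- induction; the last `1/N` is a single short piece.
    set N : ℝ := n + 1 with hN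
    have hN0 : 0 < N := by positivity
    have hl1 : (n : ℝ) / N < 1 := by rw [div_lt_one hN0]; linarith
    have hl0 : (0 : ℝ) < n / N := by positivity
    have hw1 : tnorm E x ((n / N : ℝ) • w) = n / N * tnorm E x w := by
      rw [tnorm_smul, abs_of_pos hl0]
    have hw'' : tnorm E x w / N < δ := by
      rw [div_lt_iff₀ hN0, mul_comm]; push_cast at hw'; exact hw'
    obtain ⟨γ₁, v₁, h₁, hγ₁, hv₁⟩ := ih ((n / N : ℝ) • w)
      (by rw [hw1]; nlinarith [tnorm_nonneg x w])
      (by rw [hw1, div_mul_eq_mul_div, mul_div_assoc]; exact mul_lt_mul_of_pos_left hw'' hn0)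
    -- The endpoint is still in the ball, hence in `X`, where the uniform `δ` applies.
    have hγ₁1 : γ₁ 1 ∈ X := by
      refine hball (Metric.mem_ball'.2 ?_)
      have := h₁.dist_le_one hcov
      rw [hγ₁, hv₁, hw1] at this
      nlinarith [tnorm_nonneg x w]
    have hspeed : tnorm E (γ₁ 1) (v₁ 1) = n / N * tnorm E x w := by
      rw [h₁.tnorm_eq hcov (by simp), hγ₁, hv₁, hw1]
    -- The continuation has velocity `v₁ 1 / n`, of norm `‖w‖ / N < δ`. Run at rate `N`, it matches
    -- the first part, run at rate `N / n`, at the junction `b`.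
    obtain ⟨γ₂, v₂, h₂, hγ₂, hv₂⟩ := hloc _ hγ₁1 ((n : ℝ)⁻¹ • v₁ 1) (by
      rw [tnorm_smul, abs_of_pos (inv_pos.2 hn0), hspeed]
      have : (n : ℝ)⁻¹ * (n / N * tnorm E x w) = tnorm E x w / N := by field_simp
      rwa [this])
    let b : ℝ := n / N
    have hb1 : N / n * b = 1 := by simp only [b]; field_simp
    have hb2 : N * b = n := by simp only [b]; field_simp
    have hA := h₁.comp_affine (s' := Icc 0 b) (N / n) 0 fun t ht => by
      simp only [add_zero]
      refine ⟨mul_nonneg (by positivity) ht.1, ?_⟩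
      rw [← hb1]
      exact mul_le_mul_of_nonneg_left ht.2 (by positivity)
    have hB := h₂.comp_affine (s' := Icc b 1) N (-n) fun t ht => by
      have h3 := mul_le_mul_of_nonneg_left ht.1 hN0.le
      have h4 := mul_le_mul_of_nonneg_left ht.2 hN0.le
      constructor <;> simp only <;> linarith
    simp only [add_zero] at hA
    let γ : ℝ → M := fun t => if t ≤ b then γ₁ (N / n * t) else γ₂ (N * t + -n)
    let v : ℝ → E := fun t => if t ≤ b then (N / n) • v₁ (N / n * t) else N • v₂ (N * t + -n)
    have hA' : GeodesicOn cov γ v (Icc 0 b) :=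
      hA.congr (fun t ht => if_pos ht.2) (fun t ht => if_pos ht.2)
    have hB' : GeodesicOn cov γ v (Icc b 1) := by
      refine hB.congr (fun t ht => ?_) (fun t ht => ?_)
      · rcases ht.1.eq_or_lt with rfl | hlt
        · simp only [γ, le_refl, if_true, hb1, hb2]
          rw [add_neg_cancel, hγ₂]
        · exact if_neg (not_le.2 hlt)
      · rcases ht.1.eq_or_lt with rfl | hlt
        · simp only [v, le_refl, if_true, hb1, hb2]
          rw [add_neg_cancel, hv₂, smul_smul, div_eq_mul_inv]
        · exact if_neg (not_le.2 hlt)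
    refine ⟨γ, v, hA'.union_Icc hB', ?_, ?_⟩
    · simp only [γ, b, hl0.le, if_true, mul_zero, hγ₁]
    · simp only [v, b, hl0.le, if_true, mul_zero, hv₁, smul_smul]
      rw [show N / n * (n / N) = (1 : ℝ) by field_simp, one_smul]

/-- The exponential map at `x` maps the tangent ball of radius `ρ` into `X` if `X` is compact and
contains the metric ball of radius `ρ`. -/
theorem GConvex.exists_expVec_eq (hcov : IsLeviCivita cov) (hXc : IsCompact X)
    (hX : GConvex cov X) {ρ : ℝ} (hball : Metric.ball x ρ ⊆ X) (w : E) (hw : tnorm E x w < ρ) :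
    ∃ y ∈ X, expVec cov X x y = w := by
  obtain ⟨γ, v, h, hγ0, hv0⟩ := exists_geodesicOn_of_ball_subset hcov hXc hball w hw
  have hmem : ∀ t ∈ Icc (0 : ℝ) 1, γ t ∈ X := fun t ht => by
    refine hball (Metric.mem_ball'.2 ?_)
    have := h.dist_le hcov ht
    rw [hγ0, hv0] at this
    nlinarith [tnorm_nonneg x w, ht.1, ht.2]
  exact ⟨γ 1, hmem 1 (by simp), (hX.expVec_eq h hmem hγ0 rfl).trans hv0⟩

end GConvexity

/-! ### Quadratic models, the curvature constant and the Frank-Wolfe gap. -/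

section Descent

variable {E : Type*} [NormedAddCommGroup E] [NormedSpace ℝ E] [FiniteDimensional ℝ E]
  {M : Type*} [MetricSpace M] [ChartedSpace E M] [IsManifold 𝓘(ℝ, E) ∞ M]
  [RiemannianBundle (fun x : M => TangentSpace 𝓘(ℝ, E) x)]
  [IsContMDiffRiemannianBundle 𝓘(ℝ, E) ∞ E (fun x : M => TangentSpace 𝓘(ℝ, E) x)]
  {cov : CovariantDerivative 𝓘(ℝ, E) E (TangentSpace 𝓘(ℝ, E) : M → Type _)}
  {X : Set M} {x y z : M} {φ : M → ℝ}

variable (E) in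
/-- The Riemannian gradient, regarded as an element of the model space. -/
def gradVec (φ : M → ℝ) (x : M) : E := grad φ x

theorem tinner_gradVec (φ : M → ℝ) (x : M) (w : E) :
    tinner E x (gradVec E φ x) w = mvfderiv 𝓘(ℝ, E) φ x w :=
  InnerProductSpace.toDual_symm_apply

/-- Parallel transport along a geodesic in `X` preserves the inner product with the velocity. -/
theorem GConvex.tinner_parallelTransport (hcov : IsLeviCivita cov) (hX : GConvex cov X)
    {γ : ℝ → M} {v : ℝ → E} (hγ : GeodesicOn cov γ v (Icc 0 1))
    (hmem : ∀ t ∈ Icc (0 : ℝ) 1, γ t ∈ X) (hx : γ 0 = x) (hy : γ 1 = y) {a b : E}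
    (h : IsParallelTransport cov X x y a b) :
    tinner E y b (v 1) = tinner E x a (v 0) := by
  subst hx hy
  obtain ⟨V, hV, h0, h1⟩ := h
  have hg := hX.geodesicOn_geod hγ hmem
  have hV' : ParallelOn cov (geod cov X (γ 0) (γ 1)) v (fun t => (V t : E)) (Icc 0 1) :=
    ParallelOn.congr (v := fun t => velocity (geod cov X (γ 0) (γ 1)) t)
      (V := fun t => (V t : E)) hV (fun _ _ => rfl) (fun t ht => (hg.velocity_eq ht).symm)
      (fun _ _ => rfl)
  have h2 := ParallelOn.tinner_eq hcov hg.continuousOn hV' hg.parallel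
    (t := 1) (by simp)
  have e0 := congrArg (fun p : TangentBundle 𝓘(ℝ, E) M => tinner E p.1 p.2 (v 0)) h0
  have e1 := congrArg (fun p : TangentBundle 𝓘(ℝ, E) M => tinner E p.1 p.2 (v 1)) h1
  exact e1.symm.trans (h2.trans e0)

/-- A function with `L`-Lipschitz gradient lies below its quadratic upper model. -/
theorem LipschitzGradient.le_add (hcov : IsLeviCivita cov) (hX : GConvex cov X)
    (hφd : ∀ x ∈ X, MDifferentiableAt 𝓘(ℝ, E) 𝓘(ℝ, ℝ) φ x) {L : ℝ}
    (hL : LipschitzGradient cov X φ L) (hx : x ∈ X) (hy : y ∈ X) :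
    φ y ≤ φ x + tinner E x (gradVec E φ x) (expVec cov X x y) + L / 2 * dist x y ^ 2 := by
  obtain ⟨v, hv, hv0⟩ := hX.exists_geodesicOn hx hy
  set γ := geod cov X x y with hγ
  have hγ0 : γ 0 = x := geod_zero cov X x y
  have hγ1 : γ 1 = y := hX.geod_one hx hy
  have hmem : ∀ t ∈ Icc (0 : ℝ) 1, γ t ∈ X := fun t ht => hX.geod_mem hx hy ht
  have hspeed : ∀ t ∈ Icc (0 : ℝ) 1, tnorm E (γ t) (v t) = dist x y := fun t ht => by
    rw [hv.tnorm_eq hcov ht, hγ0, hv0, hX.tnorm_expVec hcov hx hy]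
  set G := tinner E x (gradVec E φ x) (expVec cov X x y)
  have hder : ∀ t ∈ Icc (0 : ℝ) 1, HasDerivWithinAt (fun r => φ (γ r))
      (tinner E (γ t) (gradVec E φ (γ t)) (v t)) (Icc 0 1) t := fun t ht => by
    rw [tinner_gradVec]
    exact (hv.hasVelocity t ht).hasDerivWithinAt_comp (hφd _ (hmem t ht))
  -- Transporting `grad φ x` to `γ t` keeps its product with the velocity equal to `G`;
  -- Cauchy-Schwarz and the Lipschitz condition control the difference.
  have hbound : ∀ t ∈ Ioo (0 : ℝ) 1, tinner E (γ t) (gradVec E φ (γ t)) (v t) ≤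
      G + L * t * dist x y ^ 2 := by
    intro t ht
    have ht' : t ∈ Icc (0 : ℝ) 1 := Ioo_subset_Icc_self ht
    obtain ⟨b, hb, h5⟩ : ∃ b : E, IsParallelTransport cov X x (γ t) (grad φ x) b ∧
        tnorm E (γ t) (gradVec E φ (γ t) - b) ≤ L * dist (γ t) x := hL (γ t) (hmem t ht') x hx
    -- The transport runs along the geodesic from `x` to `γ t`, that is, along `γ` slowed by `t`;
    -- the factor `t > 0` then cancels.
    have h1 : tinner E (γ t) b (t • v (t * 1)) =
        tinner E x (gradVec E φ x) (t • v (t * 0)) := hX.tinner_parallelTransport hcov (hv.restrict ht')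
      (fun r hr => hmem _ ⟨mul_nonneg ht.1.le hr.1, mul_le_one₀ ht.2.le hr.1 hr.2⟩)
      (by rw [mul_zero, hγ0]) (by rw [mul_one]) hb
    simp only [mul_zero, mul_one, tinner_smul_right, hv0] at h1
    have h2 : tinner E (γ t) b (v t) = G := mul_left_cancel₀ ht.1.ne' h1
    have h3 := tinner_sub_left (E := E) (γ t) (gradVec E φ (γ t)) b (v t)
    have h4 := tinner_le (E := E) (γ t) (gradVec E φ (γ t) - b) (v t)
    have h6 : dist (γ t) x = t * dist x y := by
      rw [dist_comm]; exact hX.dist_geod hcov hx hy ht'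
    rw [h6] at h5
    rw [hspeed t ht'] at h4
    have h7 := mul_le_mul_of_nonneg_right h5 (dist_nonneg (x := x) (y := y))
    have h8 : tinner E (γ t) (gradVec E φ (γ t)) (v t) - G ≤ L * (t * dist x y) * dist x y := by
      rw [← h2]
      exact (h3.symm.trans_le h4).trans h7
    nlinarith [h8]
  have hpoly : ∀ t : ℝ, HasDerivAt (fun r : ℝ => G * r + L / 2 * r ^ 2 * dist x y ^ 2)
      (G + L * t * dist x y ^ 2) t := fun t => by
    have h1 := (hasDerivAt_id t).const_mul G
    have h2 := (((hasDerivAt_id t).pow 2).const_mul (L / 2)).mul_const (dist x y ^ 2)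
    refine (h1.add h2).congr_deriv ?_
    simp only [id, mul_one]
    push_cast
    ring
  -- Monotonicity replaces integration, so the derivative of `φ ∘ γ` need not be integrable.
  have hanti := antitoneOn_of_hasDerivWithinAt_nonpos (convex_Icc (0 : ℝ) 1)
    (f := fun r => φ (γ r) - (G * r + L / 2 * r ^ 2 * dist x y ^ 2))
    (f' := fun t => tinner E (γ t) (gradVec E φ (γ t)) (v t) - (G + L * t * dist x y ^ 2))
    (fun t ht => ((hder t ht).sub (hpoly t).hasDerivWithinAt).continuousWithinAt)
    (fun t ht => by
      rw [interior_Icc] at ht ⊢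
      exact ((hder t (Ioo_subset_Icc_self ht)).sub (hpoly t).hasDerivWithinAt).mono
        Ioo_subset_Icc_self)
    (fun t ht => by
      rw [interior_Icc] at ht
      linarith [hbound t ht])
  have := hanti (show (0 : ℝ) ∈ Icc (0 : ℝ) 1 by simp) (show (1 : ℝ) ∈ Icc (0 : ℝ) 1 by simp)
    zero_le_one
  simp only [hγ0, hγ1] at this
  linarith

/-- The curvature constant of a function with Lipschitz gradient on a compact g-convex set is
finite. -/
theorem bddAbove_curvatureValues (hcov : IsLeviCivita cov) (hXc : IsCompact X)
    (hX : GConvex cov X) (hφd : ∀ x ∈ X, MDifferentiableAt 𝓘(ℝ, E) 𝓘(ℝ, ℝ) φ x)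
    (hL : ∃ L : ℝ, LipschitzGradient cov X φ L) : BddAbove (curvatureValues cov X φ) := by
  obtain ⟨L, hL⟩ := hL
  obtain ⟨C, hC⟩ := Metric.isBounded_iff.1 hXc.isBounded
  refine ⟨|L| * C ^ 2, ?_⟩
  rintro c ⟨x, hx, z, hz, η, hη, y, rfl, rfl⟩
  have hη' : η ∈ Icc (0 : ℝ) 1 := Ioc_subset_Icc_self hη
  have hη0 : η ≠ 0 := hη.1.ne'
  have h1 := hL.le_add hcov hX hφd hx (hX.geod_mem hx hz hη')
  rw [hX.dist_geod hcov hx hz hη'] at h1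
  have h2 : φ (geod cov X x z η) - φ x -
      inner ℝ (grad φ x) (expInv cov X x (geod cov X x z η)) ≤ L / 2 * (η * dist x z) ^ 2 := by
    change _ - _ - tinner E x (gradVec E φ x) (expVec cov X x (geod cov X x z η)) ≤ _
    linarith
  -- The factor `η²` cancels since `d(x, γ(η)) = η d(x, z)`.
  calc _ ≤ 2 / η ^ 2 * (L / 2 * (η * dist x z) ^ 2) :=
        mul_le_mul_of_nonneg_left h2 (by positivity)
    _ = L * dist x z ^ 2 := by field_simp
    _ ≤ |L| * C ^ 2 := mul_le_mul (le_abs_self L)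
        (pow_le_pow_left₀ dist_nonneg (hC hx hz) 2) (by positivity) (abs_nonneg L)

/-- The definition of the constant, solved for the new value of `φ`. The case `η = 0`, outside the
supremum, is added because the step is zero at a minimizer. -/
theorem le_curvatureConst (hbdd : BddAbove (curvatureValues cov X φ)) (hX : GConvex cov X)
    (hx : x ∈ X) (hz : z ∈ X) {η : ℝ} (hη : η ∈ Icc (0 : ℝ) 1) :
    φ (geod cov X x z η) ≤ φ x + η * tinner E x (gradVec E φ x) (expVec cov X x z) +
      η ^ 2 / 2 * curvatureConst cov X φ := by
  rcases hη.1.eq_or_lt with rfl | hη0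
  · rw [geod_zero]; simp
  have h1 := le_csSup hbdd ⟨x, hx, z, hz, η, ⟨hη0, hη.2⟩, _, rfl, rfl⟩
  have h2 : inner ℝ (grad φ x) (expInv cov X x (geod cov X x z η)) =
      η * tinner E x (gradVec E φ x) (expVec cov X x z) :=
    (congrArg (tinner E x (gradVec E φ x)) (hX.expVec_geod hx hz hη)).trans (tinner_smul_right _ _ _ _)
  rw [h2, div_mul_eq_mul_div, div_le_iff₀ (by positivity)] at h1
  change _ ≤ curvatureConst cov X φ * _ at h1
  linarith

theorem le_curvatureConst_one (hbdd : BddAbove (curvatureValues cov X φ)) (hX : GConvex cov X)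
    (hx : x ∈ X) (hz : z ∈ X) :
    φ z ≤ φ x + tinner E x (gradVec E φ x) (expVec cov X x z) + curvatureConst cov X φ / 2 := by
  have := le_curvatureConst hbdd hX hx hz (η := 1) (by simp)
  rw [hX.geod_one hx hz] at this
  linarith

variable [IsRiemannianManifold 𝓘(ℝ, E) M]

/-- The gradient vanishes at an interior minimizer. -/
theorem tnorm_gradVec_eq_zero (hcov : IsLeviCivita cov) (hXc : IsCompact X) (hX : GConvex cov X)
    (hφd : ∀ x ∈ X, MDifferentiableAt 𝓘(ℝ, E) 𝓘(ℝ, ℝ) φ x) {L : ℝ}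
    (hL : LipschitzGradient cov X φ L) (hmin : IsMinOn φ X x) {r : ℝ} (hr : 0 < r)
    (hball : Metric.ball x r ⊆ X) : tnorm E x (gradVec E φ x) = 0 := by
  set N := tnorm E x (gradVec E φ x) with hN
  have hN0 : 0 ≤ N := tnorm_nonneg _ _
  by_contra hne
  have hNpos : 0 < N := lt_of_le_of_ne hN0 (Ne.symm hne)
  -- The first bound keeps `-t grad φ` inside the tangent ball of radius `r`; the second makes the
  -- decrease `t N²` exceed the error `L t² N² / 2`, contradicting minimality.
  set t := min (r / (2 * N)) (1 / (|L| + 1)) with ht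
  have htpos : 0 < t := lt_min (by positivity) (by positivity)
  have ht1 : t * N < r := by
    have := mul_le_mul_of_nonneg_right (min_le_left (r / (2 * N)) (1 / (|L| + 1))) hN0
    have h2 : r / (2 * N) * N = r / 2 := by field_simp
    rw [h2] at this
    linarith
  have ht2 : t * |L| < 1 := by
    have := min_le_right (r / (2 * N)) (1 / (|L| + 1))
    rw [le_div_iff₀ (by positivity)] at this
    nlinarith
  have hw : tnorm E x ((-t) • gradVec E φ x) = t * N := by
    rw [tnorm_smul, abs_neg, abs_of_pos htpos]
  obtain ⟨y, hy, hxy⟩ := hX.exists_expVec_eq hcov hXc hball _ (by rw [hw]; exact ht1)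
  have hx : x ∈ X := hball (Metric.mem_ball_self hr)
  have h1 := hL.le_add hcov hX hφd hx hy
  rw [← hX.tnorm_expVec hcov hx hy, hxy, hw, tinner_smul_right, tinner_self] at h1
  have h2 : φ x ≤ φ y := hmin hy
  have h3 : L ≤ |L| := le_abs_self L
  change _ ≤ _ + -t * N ^ 2 + _ at h1
  have h4 : 0 < t * N ^ 2 := by positivity
  nlinarith [mul_le_mul_of_nonneg_left h3 (show 0 ≤ t * (t * N ^ 2) by positivity)]

/-- A lower bound for the Frank-Wolfe gap when the minimizer is an interior point. -/
theorem StronglyGConvexOn.gap_le (hcov : IsLeviCivita cov) (hXc : IsCompact X)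
    (hX : GConvex cov X) {μ : ℝ} (hμ : 0 < μ) (hφμ : StronglyGConvexOn cov X φ μ) {xstar : M}
    (hmin : IsMinOn φ X xstar) {r : ℝ} (hr : 0 < r) (hball : Metric.ball xstar r ⊆ X)
    (hx : x ∈ X)
    (hz : ∀ w ∈ X, tinner E x (gradVec E φ x) (expVec cov X x z) ≤
      tinner E x (gradVec E φ x) (expVec cov X x w)) :
    r * √(μ * (φ x - φ xstar)) ≤ √2 * -tinner E x (gradVec E φ x) (expVec cov X x z) := by
  have hxs : xstar ∈ X := hball (Metric.mem_ball_self hr)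
  set G := -tinner E x (gradVec E φ x) (expVec cov X x z) with hG
  set N := tnorm E x (gradVec E φ x) with hN
  set D := dist x xstar with hD
  set Δ := φ x - φ xstar with hΔ
  have hΔ0 : 0 ≤ Δ := sub_nonneg.2 (hmin hx)
  set q := √(μ * Δ) with hq
  have hq0 : 0 ≤ q := Real.sqrt_nonneg _
  have hq2 : q ^ 2 = μ * Δ := Real.sq_sqrt (by positivity)
  have h2 : √2 ^ 2 = (2 : ℝ) := Real.sq_sqrt (by norm_num)
  have h20 : 0 < √(2 : ℝ) := by positivity
  have hN0 : 0 ≤ N := tnorm_nonneg _ _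
  have hD0 : 0 ≤ D := dist_nonneg
  have hsc : φ x + tinner E x (gradVec E φ x) (expVec cov X x xstar) + μ / 2 * D ^ 2 ≤ φ xstar :=
    hφμ x hx xstar hxs
  -- Far from the minimizer the oracle is compared with `xstar`, and the square below is the
  -- inequality of arithmetic and geometric means. Near it, steepest descent is compared.
  rcases le_or_gt (r / 2) D with hrD | hrD
  · have h3 : Δ + μ / 2 * D ^ 2 ≤ G := by linarith [hz xstar hxs]
    have h4 : √2 * q * D ≤ G := by
      have h5 : √2 * q * D * μ ≤ (Δ + μ / 2 * D ^ 2) * μ := by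
        nlinarith [sq_nonneg (√2 * q - μ * D)]
      exact (le_of_mul_le_mul_right h5 hμ).trans h3
    have h6 : √2 * (√2 * q * D) = 2 * (q * D) := by linear_combination q * D * h2
    linarith [mul_le_mul_of_nonneg_left h4 h20.le, mul_le_mul_of_nonneg_left hrD hq0]
  · have hNq : √2 * q ≤ N := by
      have h5 : -tinner E x (gradVec E φ x) (expVec cov X x xstar) ≤ N * D := by
        have h6 := tinner_le (E := E) x (gradVec E φ x) ((-1 : ℝ) • expVec cov X x xstar)
        rw [tinner_smul_right, tnorm_smul] at h6
        have h7 := hX.tnorm_expVec hcov hx hxs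
        have h8 : |(-1 : ℝ)| * tnorm E x (expVec cov X x xstar) = D := by
          rw [h7]; simp [D]
        calc _ = -1 * tinner E x (gradVec E φ x) (expVec cov X x xstar) := by ring
          _ ≤ _ := h6
          _ = N * D := congrArg (N * ·) h8
      refine le_of_sq_le_sq ?_ hN0
      -- From `Δ ≤ N D - μ D² / 2`, whose maximum over `D` is `N² / (2μ)`.
      nlinarith [sq_nonneg (N - μ * D)]
    have hGN : r / 2 * N ≤ G := by
      -- With zero gradient there is no descent direction to normalize; testing the oracle against
      -- `x` itself gives `0 ≤ G`.
      rcases hN0.eq_or_lt with hN1 | hN1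
      · have h6 := hz x hx
        have h7 : expVec cov X x x = 0 := by
          have := hX.expVec_geod hx hx (η := 0) (by simp)
          rw [geod_zero] at this
          exact this.trans (zero_smul ℝ _)
        have h8 : tinner E x (gradVec E φ x) (0 : E) = 0 := by
          have := tinner_smul_right (E := E) x (0 : ℝ) (gradVec E φ x) 0
          rwa [zero_smul, zero_mul] at this
        have h9 : tinner E x (gradVec E φ x) (expVec cov X x x) = 0 :=
          (congrArg (tinner E x (gradVec E φ x)) h7).trans h8
        rw [← hN1]; linarith
      -- Here `r - D > r / 2`, so the tangent vector of length `r / 2` opposite to the gradient is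
      -- admissible.
      · have hb : Metric.ball x (r - D) ⊆ X := fun w hw => by
          refine hball (Metric.mem_ball.2 ?_)
          have := dist_triangle w x xstar
          have := Metric.mem_ball.1 hw
          linarith
        have hw : tnorm E x ((-(r / 2 / N)) • gradVec E φ x) = r / 2 := by
          rw [tnorm_smul, abs_neg, abs_of_pos (by positivity)]
          exact div_mul_cancel₀ _ hN1.ne'
        obtain ⟨w, hwX, hw'⟩ := hX.exists_expVec_eq hcov hXc hb _ (by rw [hw]; linarith)
        have h6 := hz w hwX
        rw [hw', tinner_smul_right, tinner_self] at h6
        have h7 : -(r / 2 / N) * N ^ 2 = -(r / 2 * N) := by field_simp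
        have h8 : tinner E x (gradVec E φ x) (expVec cov X x z) ≤ -(r / 2 * N) := h6.trans_eq h7
        linarith
    have h9 : r / 2 * √2 * (√2 * q) = r * q := by linear_combination r / 2 * q * h2
    have h10 := mul_le_mul_of_nonneg_left hNq (show 0 ≤ r / 2 * √2 by positivity)
    linarith [mul_le_mul_of_nonneg_left hGN h20.le]

/-- The curvature constant dominates the strong convexity constant times the square of any distance
less than the radius of a ball in `X`. -/
theorem StronglyGConvexOn.le_curvatureConst [Nontrivial E] (hcov : IsLeviCivita cov)
    (hXc : IsCompact X) (hX : GConvex cov X) {μ : ℝ} (hφμ : StronglyGConvexOn cov X φ μ)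
    (hbdd : BddAbove (curvatureValues cov X φ)) {r : ℝ} (hball : Metric.ball x r ⊆ X) {ρ : ℝ}
    (hρ : 0 ≤ ρ) (hρr : ρ < r) : μ * ρ ^ 2 ≤ curvatureConst cov X φ := by
  have hx : x ∈ X := hball (Metric.mem_ball_self (hρ.trans_lt hρr))
  obtain ⟨e, he⟩ := exists_ne (0 : E)
  have hN : 0 < tnorm E x e := (norm_pos_iff (a := (show TangentSpace 𝓘(ℝ, E) x from e))).2 he
  have hw : tnorm E x ((ρ / tnorm E x e) • e) = ρ := by
    rw [tnorm_smul, abs_of_nonneg (by positivity), div_mul_cancel₀ _ hN.ne']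
  obtain ⟨y, hy, hxy⟩ := hX.exists_expVec_eq hcov hXc hball _ (by rw [hw]; exact hρr)
  have hd : dist x y = ρ := by rw [← hX.tnorm_expVec hcov hx hy, hxy, hw]
  -- For a point at distance exactly `ρ`, the error of the linear model is at least `μ ρ² / 2` by
  -- strong convexity and at most half the curvature constant.
  have h1 := le_curvatureConst_one hbdd hX hx hy
  have h2 : φ x + tinner E x (gradVec E φ x) (expVec cov X x y) + μ / 2 * dist x y ^ 2 ≤ φ y :=
    hφμ x hx y hy
  rw [hd] at h2
  linarith

end Descent

end RFW

end

/-! ### Linear convergence. -/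

theorem theorem2
    {E : Type*} [NormedAddCommGroup E] [NormedSpace ℝ E] [FiniteDimensional ℝ E] [Nontrivial E]
    {M : Type*} [MetricSpace M] [ChartedSpace E M] [IsManifold 𝓘(ℝ, E) ∞ M]
    [RiemannianBundle (fun x : M => TangentSpace 𝓘(ℝ, E) x)]
    [IsContMDiffRiemannianBundle 𝓘(ℝ, E) ∞ E (fun x : M => TangentSpace 𝓘(ℝ, E) x)]
    [IsRiemannianManifold 𝓘(ℝ, E) M]
    (cov : CovariantDerivative 𝓘(ℝ, E) E (TangentSpace 𝓘(ℝ, E) : M → Type _))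
    (hcov : RFW.IsLeviCivita cov)
    (X : Set M) (hXc : IsCompact X) (hXg : RFW.GConvex cov X)
    (φ : M → ℝ) (hφd : ∀ x ∈ X, MDifferentiableAt 𝓘(ℝ, E) 𝓘(ℝ, ℝ) φ x)
    (hφL : ∃ L : ℝ, RFW.LipschitzGradient cov X φ L)
    (μ : ℝ) (hμ : 0 < μ) (hφμ : RFW.StronglyGConvexOn cov X φ μ)
    (xstar : M) (hmin : IsMinOn φ X xstar)
    (r : ℝ) (hr : 0 < r) (hball : Metric.ball xstar r ⊆ X)
    (s : ℕ → ℝ) (x z : ℕ → M) (hrun : RFW.IsRun cov X φ s x z)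
    (hs : ∀ k, s k = r * √(μ * (φ (x k) - φ xstar)) / (√2 * RFW.curvatureConst cov X φ)) :
    BddAbove (RFW.curvatureValues cov X φ) ∧
    0 < RFW.curvatureConst cov X φ ∧
    r ^ 2 * μ / (4 * RFW.curvatureConst cov X φ) ∈ Ioo (0 : ℝ) 1 ∧
    (∀ k, x k ∈ X ∧ s k ∈ Icc (0 : ℝ) 1) ∧
    (∀ k, φ (x (k + 1)) - φ xstar ≤
      (1 - r ^ 2 * μ / (4 * RFW.curvatureConst cov X φ)) * (φ (x k) - φ xstar)) ∧
    (∀ k, φ (x k) - φ xstar ≤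
      (1 - r ^ 2 * μ / (4 * RFW.curvatureConst cov X φ)) ^ k * (φ (x 0) - φ xstar)) := by
  obtain ⟨L, hL⟩ := hφL
  have hxs : xstar ∈ X := hball (Metric.mem_ball_self hr)
  have hbdd := RFW.bddAbove_curvatureValues hcov hXc hXg hφd ⟨L, hL⟩
  -- Any radius strictly between `r / 2` and `r` would serve: the rate is below 1 once the constant
  -- exceeds `μ (r / 2)²`.
  have hAlow : μ * (3 / 4 * r) ^ 2 ≤ RFW.curvatureConst cov X φ :=
    hφμ.le_curvatureConst hcov hXc hXg hbdd hball (by positivity) (by linarith)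
  have hgrad := RFW.tnorm_gradVec_eq_zero hcov hXc hXg hφd hL hmin hr hball
  -- In the curvature bound based at `xstar` the linear term vanishes with the gradient.
  have hupper : ∀ p ∈ X, φ p - φ xstar ≤ RFW.curvatureConst cov X φ / 2 := fun p hp => by
    have h1 := RFW.le_curvatureConst_one hbdd hXg hxs hp
    have h2 := RFW.tinner_le xstar (RFW.gradVec E φ xstar) (RFW.expVec cov X xstar p)
    rw [hgrad, zero_mul] at h2
    linarith
  have hstep : ∀ k, x k ∈ X → s k ∈ Icc (0 : ℝ) 1 → φ (x (k + 1)) ≤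
      φ (x k) + s k * RFW.tinner E (x k) (RFW.gradVec E φ (x k)) (RFW.expVec cov X (x k) (z k)) +
        s k ^ 2 / 2 * RFW.curvatureConst cov X φ := fun k hk hsk => by
    rw [hrun.step k]
    exact RFW.le_curvatureConst hbdd hXg hk (hrun.oracle_mem k) hsk
  have hgap : ∀ k, x k ∈ X → r * √(μ * (φ (x k) - φ xstar)) ≤ √2 *
      -RFW.tinner E (x k) (RFW.gradVec E φ (x k)) (RFW.expVec cov X (x k) (z k)) := fun k hk =>
    hφμ.gap_le hcov hXc hXg hμ hmin hr hball hk (hrun.oracle_min k)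
  set A := RFW.curvatureConst cov X φ
  have hpos : 0 < r ^ 2 * μ := by positivity
  have hA : 0 < A := lt_of_lt_of_le (by positivity) hAlow
  have hrate0 : 0 < r ^ 2 * μ / (4 * A) := by positivity
  have hrate1 : r ^ 2 * μ / (4 * A) < 1 := by
    rw [div_lt_one (by positivity)]; linarith
  have hgap0 : ∀ p ∈ X, 0 ≤ φ p - φ xstar := fun p hp => sub_nonneg.2 (hmin hp)
  have h2 : √2 ^ 2 = (2 : ℝ) := Real.sq_sqrt (by norm_num)
  have hs0 : ∀ k, 0 ≤ s k := fun k => by rw [hs k]; positivity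
  have hsq : ∀ k, x k ∈ X → s k ^ 2 * A = r ^ 2 * μ / (2 * A) * (φ (x k) - φ xstar) :=
    fun k hk => by
      rw [hs k, div_pow, mul_pow, mul_pow, h2, Real.sq_sqrt (mul_nonneg hμ.le (hgap0 _ hk))]
      field_simp
  have hs1 : ∀ k, x k ∈ X → s k ≤ 1 := fun k hk => by
    -- Since `Δ_k ≤ A / 2`, the squared step is at most the rate `r²μ / (4A) < 1`.
    have h3 : s k ^ 2 * A ≤ r ^ 2 * μ / (4 * A) * A := by
      rw [hsq k hk]
      calc _ ≤ r ^ 2 * μ / (2 * A) * (A / 2) :=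
            mul_le_mul_of_nonneg_left (hupper _ hk) (by positivity)
        _ = _ := by field_simp; norm_num
    have h4 := (le_of_mul_le_mul_right h3 hA).trans hrate1.le
    exact (sq_le_one_iff₀ (hs0 k)).1 h4
  have hmem : ∀ k, x k ∈ X := fun k => by
    induction k with
    | zero => exact hrun.init
    | succ k ih =>
      rw [hrun.step k]
      exact hXg.geod_mem ih (hrun.oracle_mem k) ⟨hs0 k, hs1 k ih⟩
  have hdesc : ∀ k, φ (x (k + 1)) - φ xstar ≤
      (1 - r ^ 2 * μ / (4 * A)) * (φ (x k) - φ xstar) := fun k => by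
    have h3 := hstep k (hmem k) ⟨hs0 k, hs1 k (hmem k)⟩
    have h4 := hgap k (hmem k)
    have h5 := hsq k (hmem k)
    set G := RFW.tinner E (x k) (RFW.gradVec E φ (x k)) (RFW.expVec cov X (x k) (z k))
    have h6 : r * √(μ * (φ (x k) - φ xstar)) = √2 * (s k * A) := by
      rw [hs k]; field_simp
    rw [h6] at h4
    -- The step is the lower bound on the gap divided by `A`, so the gain `s (-G)` is at least `s²
    -- A`; half of it pays for the curvature term, leaving `s² A / 2`.
    have h7 : s k * A ≤ -G := le_of_mul_le_mul_left h4 (by positivity)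
    have h8 := mul_le_mul_of_nonneg_left h7 (hs0 k)
    have h9 : r ^ 2 * μ / (2 * A) = 2 * (r ^ 2 * μ / (4 * A)) := by field_simp; norm_num
    rw [h9] at h5
    linarith
  refine ⟨hbdd, hA, ⟨hrate0, hrate1⟩, fun k => ⟨hmem k, hs0 k, hs1 k (hmem k)⟩, hdesc,
    fun k => ?_⟩
  induction k with
  | zero => simp
  | succ k ih =>
    calc _ ≤ _ := hdesc k
      _ ≤ _ := mul_le_mul_of_nonneg_left ih (sub_nonneg.2 hrate1.le)
      _ = _ := by ring
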